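/- Let $1\le k\le n$, and let $G$ be the path graph with nodes $1,\dots,n$ in order along the path and with link weights $W_{ij}=W_{ji}>0$ for neighbouring nodes $i,j$. Let $L$ be the weighted Laplacian, $L_{ij}=-W_{ij}$ if $i,j$ are neighbours, $L_{ii}=\sum_{j\in N(i)}W_{ij}$, and $L_{ij}=0$ otherwise. For a leader set $S\subseteq\{1,\dots,n\}$ let $L_{ff}$ be the submatrix of $L$ obtained by deleting the rows and columns of the nodes in $S$, and let $C(S)$ be the smallest eigenvalue of $L_{ff}$, with $C(S)=+\infty$ if $S$ contains all nodes. Consider the following algorithm with input $n$, $k$, $W$. (1) Compute $L$. (2) Form the weighted digraph with nodes $s=0,1,\dots,n,t=n+1$ and an edge $(u,v)$ for all $u<v$ other than $(s,t)$; the weight $w(u,v)$ is the smallest eigenvalue of the submatrix of $L$ with rows and columns $u+1,\dots,v-1$, and $+\infty$ if $v=u+1$. (3) With $H=k+1$, put $d_0(s)=+\infty$ and all other initial values $d_m(v)=-\infty$, and for $m=1,\dots,H$ and every node $v$ compute $d_m(v)=\max_{u}\min\{d_{m-1}(u),w(u,v)\}$ over all edges $(u,v)$, together with a maximizing predecessor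 $\pi_m(v)$ (the Bellman--Ford iteration for the widest path problem). (4) Starting from $\ell=H$, decrease $\ell$ by $1$ as long as $d_\ell(t)=d_{\ell-1}(t)$; follow the predecessors back from $t$, starting with $\pi_\ell(t)$, to obtain a path of $\ell$ edges from $s$ to $t$, and return as $S$ the nodes of the path other than $s,t$. Then $|S|\le k$, and $C(S)\ge C(S')$ for every $S'\subseteq\{1,\dots,n\}$ with $|S'|\le k$. Moreover the algorithm takes $O(n^3)$ operations, uniformly in $k$ and $W$: on a random access machine over the extended reals in which constants, register and array accesses, arithmetic operations, comparisons, assignments and loop steps are single operations and the computation of the smallest eigenvalue of an $m\times m$ symmetric tridiagonal matrix is charged $\kappa m$ operations, for any fixed constant $\kappa$, there is a constant depending only on $\kappa$ such that the number of operations is at most this constant times $n^3$. -/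

import Mathlib

/-! ## Weighted path graphs, consensus Laplacian, convergence rate -/

/-- The smallest real eigenvalue of a real square matrix, as an extended real number.  For a
nonempty symmetric matrix the infimum is attained; for the `0 × 0` matrix the value is `+∞`. -/
noncomputable def lambdaMin {ι : Type*} [Fintype ι] [DecidableEq ι] (A : Matrix ι ι ℝ) : EReal :=
  sInf {x : EReal | ∃ μ : ℝ, Module.End.HasEigenvalue (Matrix.toLin' A) μ ∧ x = (μ : EReal)}

open Classical in
/-- The weighted Laplacian of a graph with link weights `W`. -/
noncomputable def weightedLaplacian {V : Type*} [Fintype V] (G : SimpleGraph V) (W : V → V → ℝ) :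
    Matrix V V ℝ := fun i j =>
  if i = j then ∑ l with G.Adj i l, W i l else if G.Adj i j then - W i j else 0

/-- `C(S)`: the smallest eigenvalue of the follower-follower block of the Laplacian, obtained by
deleting the rows and columns of the leaders `S`. -/
noncomputable def convRate {V : Type*} [Fintype V] [DecidableEq V] (G : SimpleGraph V)
    (W : V → V → ℝ) (S : Finset V) : EReal :=
  lambdaMin ((weightedLaplacian G W).submatrix
    (fun i : {v : V // v ∉ S} => (i : V)) (fun i : {v : V // v ∉ S} => (i : V)))

/-! ## A random access machine over the extended reals, with a step count -/

namespace RealRAM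

/-- Natural number registers. -/
inductive NVar
  | n | k | h | i | j | u | v | m | lo | len | last
  deriving DecidableEq

/-- Arrays of natural numbers (two indices). -/
inductive NArr
  | pre | path | leader
  deriving DecidableEq

/-- Arrays of extended real numbers (two indices). -/
inductive RArr
  | weight | lap | width | dist | out
  deriving DecidableEq

/-- The contents of the memory. -/
structure Store where
  nat : NVar → ℕ
  narr : NArr → ℕ → ℕ → ℕ
  rarr : RArr → ℕ → ℕ → EReal

/-- Write a natural number register. -/
def Store.setNat (σ : Store) (r : NVar) (x : ℕ) : Store :=
  { σ with nat := fun r' => if r' = r then x else σ.nat r' }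

/-- Write a cell of an array of natural numbers. -/
def Store.setNArr (σ : Store) (A : NArr) (p q x : ℕ) : Store :=
  { σ with narr := fun A' p' q' => if A' = A ∧ p' = p ∧ q' = q then x else σ.narr A' p' q' }

/-- Write a cell of an array of extended real numbers. -/
def Store.setRArr (σ : Store) (A : RArr) (p q : ℕ) (x : EReal) : Store :=
  { σ with rarr := fun A' p' q' => if A' = A ∧ p' = p ∧ q' = q then x else σ.rarr A' p' q' }

/-- Natural number expressions: constants, registers, sum, truncated difference, array access. -/
inductive NExp
  | lit (a : ℕ)
  | var (r : NVar)
  | add (a b : NExp)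
  | sub (a b : NExp)
  | get (A : NArr) (a b : NExp)

def NExp.eval (σ : Store) : NExp → ℕ
  | lit a => a
  | var r => σ.nat r
  | add a b => a.eval σ + b.eval σ
  | sub a b => a.eval σ - b.eval σ
  | get A a b => σ.narr A (a.eval σ) (b.eval σ)

/-- One operation for every constant, register access, arithmetic operation and array access. -/
def NExp.cost : NExp → ℕ
  | lit _ => 1
  | var _ => 1
  | add a b => a.cost + b.cost + 1
  | sub a b => a.cost + b.cost + 1
  | get _ a b => a.cost + b.cost + 1

/-- Extended real expressions. -/
inductive RExp
  | zero
  | top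
  | bot
  | get (A : RArr) (a b : NExp)
  | add (x y : RExp)
  | neg (x : RExp)
  | min (x y : RExp)

noncomputable def RExp.eval (σ : Store) : RExp → EReal
  | zero => 0
  | top => ⊤
  | bot => ⊥
  | get A a b => σ.rarr A (a.eval σ) (b.eval σ)
  | add x y => x.eval σ + y.eval σ
  | neg x => - x.eval σ
  | min x y => Min.min (x.eval σ) (y.eval σ)

def RExp.cost : RExp → ℕ
  | zero => 1
  | top => 1
  | bot => 1
  | get _ a b => a.cost + b.cost + 1
  | add x y => x.cost + y.cost + 1
  | neg x => x.cost + 1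
  | min x y => x.cost + y.cost + 1

/-- Tests. -/
inductive BExp
  | ltN (a b : NExp)
  | eqN (a b : NExp)
  | ltR (x y : RExp)
  | eqR (x y : RExp)
  | not (p : BExp)
  | and (p q : BExp)

/-- Truth of a test; `ltN`, `eqN` compare natural numbers and `ltR`, `eqR` extended reals. -/
def BExp.holds (σ : Store) : BExp → Prop
  | ltN a b => a.eval σ < b.eval σ
  | eqN a b => a.eval σ = b.eval σ
  | ltR x y => x.eval σ < y.eval σ
  | eqR x y => x.eval σ = y.eval σ
  | not p => ¬ p.holds σ
  | and p q => p.holds σ ∧ q.holds σ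

def BExp.cost : BExp → ℕ
  | ltN a b => a.cost + b.cost + 1
  | eqN a b => a.cost + b.cost + 1
  | ltR x y => x.cost + y.cost + 1
  | eqR x y => x.cost + y.cost + 1
  | not p => p.cost + 1
  | and p q => p.cost + q.cost + 1

/-- Programs.  `loop r a b c` runs `c` for `r = a, …, b - 1` (bounds evaluated once, at entry);
`eig A p q M a b` writes into `A[p][q]` the smallest eigenvalue of the symmetric tridiagonal matrix
that occupies the rows and columns `a, …, b - 1` of the array `M`. -/
inductive Cmd
  | skip
  | seq (c₁ c₂ : Cmd)
  | setN (r : NVar) (a : NExp)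
  | putN (A : NArr) (p q a : NExp)
  | putR (A : RArr) (p q : NExp) (x : RExp)
  | ite (p : BExp) (c₁ c₂ : Cmd)
  | loop (r : NVar) (a b : NExp) (c : Cmd)
  | eig (A : RArr) (p q : NExp) (M : RArr) (a b : NExp)

/-- The symmetric tridiagonal `m × m` matrix given by the diagonal and the first superdiagonal of
the rows and columns `a, …, a + m - 1` of the array `M`. -/
noncomputable def tridiagonal (M : ℕ → ℕ → EReal) (a m : ℕ) : Matrix (Fin m) (Fin m) ℝ :=
  fun i j =>
    if i = j then (M (a + i) (a + i)).toReal
    else if (i : ℕ) + 1 = j then (M (a + i) (a + j)).toReal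
    else if (j : ℕ) + 1 = i then (M (a + j) (a + i)).toReal
    else 0

/-- Run a body for the values `a, …, a + m - 1` of a counter, with the number of operations (one
operation per round for the counter). -/
def rounds (f : ℕ → Store → Store × ℕ) (a : ℕ) : ℕ → Store → Store × ℕ
  | 0, σ => (σ, 0)
  | m + 1, σ =>
    ((f (a + m) (rounds f a m σ).1).1,
      (rounds f a m σ).2 + (f (a + m) (rounds f a m σ).1).2 + 1)

open Classical in
/-- Execution: the final memory together with the number of operations.  All operations have unit
cost, except that the smallest eigenvalue of an `m × m` symmetric tridiagonal matrix is charged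
`κ * m` operations. -/
noncomputable def exec (κ : ℕ) : Cmd → Store → Store × ℕ
  | .skip, σ => (σ, 1)
  | .seq c₁ c₂, σ =>
    ((exec κ c₂ (exec κ c₁ σ).1).1, (exec κ c₁ σ).2 + (exec κ c₂ (exec κ c₁ σ).1).2)
  | .setN r a, σ => (σ.setNat r (a.eval σ), a.cost + 1)
  | .putN A p q a, σ =>
    (σ.setNArr A (p.eval σ) (q.eval σ) (a.eval σ), p.cost + q.cost + a.cost + 1)
  | .putR A p q x, σ =>
    (σ.setRArr A (p.eval σ) (q.eval σ) (x.eval σ), p.cost + q.cost + x.cost + 1)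
  | .ite p c₁ c₂, σ =>
    if p.holds σ then ((exec κ c₁ σ).1, p.cost + 1 + (exec κ c₁ σ).2)
    else ((exec κ c₂ σ).1, p.cost + 1 + (exec κ c₂ σ).2)
  | .loop r a b c, σ =>
    ((rounds (fun x τ => exec κ c (τ.setNat r x)) (a.eval σ) (b.eval σ - a.eval σ) σ).1,
      a.cost + b.cost + 1 +
        (rounds (fun x τ => exec κ c (τ.setNat r x)) (a.eval σ) (b.eval σ - a.eval σ) σ).2)
  | .eig A p q M a b, σ =>
    (σ.setRArr A (p.eval σ) (q.eval σ)
        (lambdaMin (tridiagonal (σ.rarr M) (a.eval σ) (b.eval σ - a.eval σ))),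
      p.cost + q.cost + a.cost + b.cost + 1 + κ * (b.eval σ - a.eval σ))

/-! ## The leader selection algorithm for fast convergence in a path graph

The nodes of the path are `1, …, n`; in the digraph the source `s` is `0` and the target `t` is
`n + 1`. -/

infixr:60 " ;; " => Cmd.seq

/-- The node `t`. -/
def target : NExp := .add (.var .n) (.lit 1)

/-- `L ←` Laplacian of the weighted path graph. -/
def buildLaplacian : Cmd :=
  .loop .i (.lit 1) (.add (.var .n) (.lit 1))
    (.loop .j (.lit 1) (.add (.var .n) (.lit 1))
        (.putR .lap (.var .i) (.var .j) .zero) ;;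
      .ite (.ltN (.lit 1) (.var .i))
        (.putR .lap (.var .i) (.var .i)
            (.add (.get .lap (.var .i) (.var .i))
              (.get .weight (.var .i) (.sub (.var .i) (.lit 1)))) ;;
          .putR .lap (.var .i) (.sub (.var .i) (.lit 1))
            (.neg (.get .weight (.var .i) (.sub (.var .i) (.lit 1)))))
        .skip ;;
      .ite (.ltN (.var .i) (.var .n))
        (.putR .lap (.var .i) (.var .i)
            (.add (.get .lap (.var .i) (.var .i))
              (.get .weight (.var .i) (.add (.var .i) (.lit 1)))) ;;
          .putR .lap (.var .i) (.add (.var .i) (.lit 1))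
            (.neg (.get .weight (.var .i) (.add (.var .i) (.lit 1)))))
        .skip)

/-- The weights of the digraph: the edges are the pairs `u < v` other than `(s, t)`, and the weight
of `(u, v)` is the smallest eigenvalue of the rows and columns `u + 1, …, v - 1` of `L`, or `+∞` if
`v = u + 1`. -/
def buildDigraph : Cmd :=
  .loop .u (.lit 0) target
    (.loop .v (.add (.var .u) (.lit 1)) (.add target (.lit 1))
      (.ite (.eqN (.var .v) (.add (.var .u) (.lit 1)))
        (.putR .width (.var .u) (.var .v) .top)
        (.ite (.and (.eqN (.var .u) (.lit 0)) (.eqN (.var .v) target))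
          .skip
          (.eig .width (.var .u) (.var .v) .lap (.add (.var .u) (.lit 1)) (.var .v)))))

/-- Initialization of `d_m(v)` and of the predecessors `π_m(v)` for `m = 0, …, h`; the value
`n + 2` is the mark for `no predecessor`. -/
def initBellmanFord : Cmd :=
  .loop .m (.lit 0) (.add (.var .h) (.lit 1))
    (.loop .v (.lit 0) (.add target (.lit 1))
      (.putR .dist (.var .m) (.var .v) .bot ;;
        .putN .pre (.var .m) (.var .v) (.add target (.lit 1)))) ;;
  .putR .dist (.lit 0) (.lit 0) .top

/-- The candidate `min {d_{m-1}(u), w(u,v)}`. -/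
def candidate : RExp :=
  .min (.get .dist (.sub (.var .m) (.lit 1)) (.var .u)) (.get .width (.var .u) (.var .v))

/-- For `m = 1, …, h` and all nodes `v`: `d_m(v)` becomes the maximum of the candidates over the
edges `(u, v)`, and `π_m(v)` becomes a maximizing `u` (if the maximum is not `-∞`). -/
def mainBellmanFord : Cmd :=
  .loop .m (.lit 1) (.add (.var .h) (.lit 1))
    (.loop .v (.lit 0) (.add target (.lit 1))
      (.ite (.eqN (.var .v) target) (.setN .lo (.lit 1)) (.setN .lo (.lit 0)) ;;
        .loop .u (.var .lo) (.var .v)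
          (.ite (.ltR (.get .dist (.var .m) (.var .v)) candidate)
            (.putR .dist (.var .m) (.var .v) candidate ;;
              .putN .pre (.var .m) (.var .v) (.var .u))
            .skip)))

/-- Starting from `h`, decrease `last` as long as `d_last(t) = d_{last-1}(t)`. -/
def chooseLength : Cmd :=
  .setN .last (.var .h) ;;
  .loop .i (.lit 0) (.var .h)
    (.ite (.eqR (.get .dist (.var .last) target)
        (.get .dist (.sub (.var .last) (.lit 1)) target))
      (.setN .last (.sub (.var .last) (.lit 1)))
      .skip)

/-- Retrieve the nodes of the path from the predecessors: `t`, then `u = π_last(t)`, then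
`u ← π_j(u)` for `j = last - 1, …, 2`. -/
def retrievePath : Cmd :=
  .putN .path (.lit 0) (.lit 0) target ;;
  .setN .u (.get .pre (.var .last) target) ;;
  .putN .path (.lit 1) (.lit 0) (.var .u) ;;
  .setN .len (.lit 2) ;;
  .loop .i (.lit 2) (.var .last)
    (.setN .j (.sub (.add (.var .last) (.lit 1)) (.var .i)) ;;
      .setN .u (.get .pre (.var .j) (.var .u)) ;;
      .putN .path (.var .len) (.lit 0) (.var .u) ;;
      .setN .len (.add (.var .len) (.lit 1)))

/-- `S ← P \ {s, t}`, as a table of membership bits; the width of the path is also returned. -/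
def writeLeaders : Cmd :=
  .loop .i (.lit 0) (.add target (.lit 1))
    (.putN .leader (.var .i) (.lit 0) (.lit 0)) ;;
  .loop .i (.lit 0) (.var .len)
    (.setN .u (.get .path (.var .i) (.lit 0)) ;;
      .ite (.and (.not (.eqN (.var .u) (.lit 0))) (.not (.eqN (.var .u) target)))
        (.putN .leader (.var .u) (.lit 0) (.lit 1))
        .skip) ;;
  .putR .out (.lit 0) (.lit 0) (.get .dist (.var .last) target)

/-- The `k`-leader selection algorithm for fast convergence in a path graph: a widest path from
`s` to `t` with at most `h = k + 1` edges. -/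
def leaderSelection : Cmd :=
  buildLaplacian ;;
  buildDigraph ;;
  .setN .h (.add (.var .k) (.lit 1)) ;;
  initBellmanFord ;;
  mainBellmanFord ;;
  chooseLength ;;
  retrievePath ;;
  writeLeaders

/-- The input: `n`, `k` and the link weights; node `i : Fin n` has the number `i + 1`. -/
noncomputable def input (n k : ℕ) (W : Fin n → Fin n → ℝ) : Store where
  nat := fun r => if r = .n then n else if r = .k then k else 0
  narr := fun _ _ _ => 0
  rarr := fun A p q =>
    if h : A = .weight ∧ (1 ≤ p ∧ p ≤ n) ∧ (1 ≤ q ∧ q ≤ n) then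
      ((W ⟨p - 1, by omega⟩ ⟨q - 1, by omega⟩ : ℝ) : EReal)
    else 0

/-- The leader set that a memory represents. -/
def leaderSet (n : ℕ) (σ : Store) : Finset (Fin n) :=
  Finset.univ.filter fun i => σ.narr .leader ((i : ℕ) + 1) 0 = 1

/-- The leader set returned by the algorithm. -/
noncomputable def output (κ n k : ℕ) (W : Fin n → Fin n → ℝ) : Finset (Fin n) :=
  leaderSet n (exec κ leaderSelection (input n k W)).1

/-- The number of operations of the algorithm. -/
noncomputable def operations (κ n k : ℕ) (W : Fin n → Fin n → ℝ) : ℕ :=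
  (exec κ leaderSelection (input n k W)).2

end RealRAM

/-! ### Smallest eigenvalues, principal submatrices and uncoupled blocks. -/

section LambdaMin

variable {ι : Type*} [Fintype ι] [DecidableEq ι]

/-! The Laplacian of a path is tridiagonal, so deleting the leaders splits it into uncoupled blocks,
one for each run of followers between consecutive nodes of `S ∪ {s, t}`. Hence `C(S)` is the
smallest weight on the path from `s` through the leaders to `t`, and choosing `k` leaders means
finding a widest path with `k + 1` edges. Smaller leader sets may be enlarged, since passing to a
principal submatrix cannot lower the smallest eigenvalue.

Optimality is a pair of inequalities that meet at `widest W (k + 1) (n + 1)`. No admissible set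
exceeds this value (`convRate_le_widest`, from `lambdaMin_le_lambdaMin_submatrix`). The set read off
from valid predecessors reaches it (`le_convRate_of_isPred`, from `le_lambdaMin_of_blocks`).

The program is treated by a Hoare logic in which `Runs` carries a postcondition together with an
operation bound. Loop invariants identify the tables with `blockWidth` and `widest`; each loop costs
one factor `n`. The cubic terms come from the `O(n ^ 2)` eigenvalue computations of cost `O(n)` and
from the `k + 1 ≤ n + 1` rounds of Bellman-Ford over `O(n ^ 2)` edges. -/

theorem lambdaMin_le {A : Matrix ι ι ℝ} {μ : ℝ}
    (h : Module.End.HasEigenvalue (Matrix.toLin' A) μ) : lambdaMin A ≤ μ :=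
  sInf_le ⟨μ, h, rfl⟩

/-- There are only finitely many eigenvalues, so the infimum is attained or is `⊤`. This keeps the
optimal width apart from the mark `⊥` for unreachable nodes. -/
theorem lambdaMin_ne_bot (A : Matrix ι ι ℝ) : lambdaMin A ≠ ⊥ := by
  unfold lambdaMin
  set s := {x : EReal | ∃ μ : ℝ, Module.End.HasEigenvalue (Matrix.toLin' A) μ ∧ x = (μ : EReal)}
    with hs
  have hfin : s.Finite := by
    have h : {μ : ℝ | Module.End.HasEigenvalue (Matrix.toLin' A) μ}.Finite :=
      Module.End.finite_hasEigenvalue _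
    refine (h.image (fun μ : ℝ => (μ : EReal))).subset ?_
    rintro _ ⟨μ, hμ, rfl⟩
    exact ⟨μ, hμ, rfl⟩
  rcases s.eq_empty_or_nonempty with h | h
  · rw [h, sInf_empty]
    exact top_ne_bot
  · obtain ⟨μ, -, h2⟩ := h.csInf_mem hfin
    rw [h2]
    exact EReal.coe_ne_bot μ

/-- The Rayleigh quotient bound: if all eigenvalues exceeded `μ`, then `A - μ • 1` would be positive
definite, against the value of its form at `x`. -/
theorem exists_hasEigenvalue_le {A : Matrix ι ι ℝ} (hA : A.IsSymm) {x : ι → ℝ} (hx : x ≠ 0)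
    {μ : ℝ} (h : x ⬝ᵥ A.mulVec x ≤ μ * (x ⬝ᵥ x)) :
    ∃ ν ≤ μ, Module.End.HasEigenvalue (Matrix.toLin' A) ν := by
  by_contra! hcon
  have hH : (A - μ • (1 : Matrix ι ι ℝ)).IsHermitian := by
    rw [Matrix.IsHermitian, Matrix.conjTranspose_eq_transpose_of_trivial]
    simp [hA.eq]
  have hpos : (A - μ • (1 : Matrix ι ι ℝ)).PosDef := by
    rw [hH.posDef_iff_eigenvalues_pos]
    intro i
    by_contra! hi
    refine hcon (hH.eigenvalues i + μ) (by linarith) ?_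
    have hv := hH.mulVec_eigenvectorBasis i
    refine Module.End.hasEigenvalue_of_hasEigenvector
      (x := (WithLp.ofLp (hH.eigenvectorBasis i))) ⟨?_, ?_⟩
    · rw [Module.End.mem_eigenspace_iff, Matrix.toLin'_apply]
      rw [Matrix.sub_mulVec, Matrix.smul_mulVec, Matrix.one_mulVec, sub_eq_iff_eq_add] at hv
      rw [hv, add_smul]
    · intro h0
      have := hH.eigenvectorBasis.orthonormal.ne_zero i
      exact this ((WithLp.ofLp_eq_zero 2).1 h0)
  have h2 := hpos.dotProduct_mulVec_pos hx
  rw [Matrix.sub_mulVec, Matrix.smul_mulVec, Matrix.one_mulVec, dotProduct_sub,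
    dotProduct_smul, smul_eq_mul, star_trivial] at h2
  linarith

/-- The smallest eigenvalue does not decrease when passing to a principal submatrix. -/
theorem lambdaMin_le_lambdaMin_submatrix {κ : Type*} [Fintype κ] [DecidableEq κ]
    {A : Matrix ι ι ℝ} (hA : A.IsSymm) {f : κ → ι} (hf : Function.Injective f) :
    lambdaMin A ≤ lambdaMin (A.submatrix f f) := by
  refine le_sInf ?_
  rintro _ ⟨μ, hμ, rfl⟩
  obtain ⟨y, hy⟩ := hμ.exists_hasEigenvector
  have hy1 : (A.submatrix f f).mulVec y = μ • y := by
    simpa [Module.End.mem_eigenspace_iff] using hy.1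
  -- Extension by zero preserves the norm and the quadratic form, so the Rayleigh quotient of `A` at
  -- `x` is `μ`.
  set x : ι → ℝ := Function.extend f y 0 with hx
  have hxf (a : κ) : x (f a) = y a := hf.extend_apply _ _ _
  have hx0 (i : ι) (hi : i ∉ Set.range f) : x i = 0 := by
    rw [hx, Function.extend_apply' _ _ _ (by simpa using hi)]
    rfl
  have hsum (g : ι → ℝ) : x ⬝ᵥ g = y ⬝ᵥ (fun a => g (f a)) := by
    refine (Fintype.sum_of_injective f hf _ _ ?_ ?_).symm
    · intro i hi
      simp [hx0 i hi]
    · intro a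
      simp [hxf]
  have hx_ne : x ≠ 0 := by
    intro h
    refine hy.2 (funext fun a => ?_)
    rw [← hxf, h]
    rfl
  have hmul (a : κ) : A.mulVec x (f a) = (A.submatrix f f).mulVec y a := by
    rw [Matrix.mulVec, dotProduct_comm, hsum, dotProduct_comm]
    rfl
  obtain ⟨ν, hν, hν'⟩ := exists_hasEigenvalue_le hA hx_ne (μ := μ) (by
    rw [hsum, hsum, funext hmul, hy1, dotProduct_smul, smul_eq_mul]
    simp [hxf])
  exact (lambdaMin_le hν').trans (by exact_mod_cast hν)

/-- A lower bound of the smallest eigenvalues of diagonal blocks, which cover the indices and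
which are not coupled to the other indices, bounds the smallest eigenvalue. -/
theorem le_lambdaMin_of_blocks {A : Matrix ι ι ℝ} {D : EReal}
    (h : ∀ i : ι, ∃ (m : ℕ) (f : Fin m → ι), Function.Injective f ∧ i ∈ Set.range f ∧
      (∀ a, ∀ j ∉ Set.range f, A (f a) j = 0) ∧ D ≤ lambdaMin (A.submatrix f f)) :
    D ≤ lambdaMin A := by
  refine le_sInf ?_
  rintro _ ⟨μ, hμ, rfl⟩
  obtain ⟨x, hx⟩ := hμ.exists_hasEigenvector
  have hx1 : A.mulVec x = μ • x := by
    simpa [Module.End.mem_eigenspace_iff] using hx.1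
  -- Take the block through an index where the eigenvector does not vanish. As the block is
  -- uncoupled, the restriction is again an eigenvector for `μ`.
  obtain ⟨i, hi⟩ := Function.ne_iff.1 hx.2
  obtain ⟨m, f, hf, ⟨b, rfl⟩, hA, hD⟩ := h i
  refine hD.trans (lambdaMin_le (Module.End.hasEigenvalue_of_hasEigenvector (x := x ∘ f) ⟨?_, ?_⟩))
  · rw [Module.End.mem_eigenspace_iff, Matrix.toLin'_apply]
    funext a
    have h1 := congrFun hx1 (f a)
    calc _ = A.mulVec x (f a) :=
          Fintype.sum_of_injective f hf _ _ (fun j hj => by simp [hA a j hj]) (fun _ => rfl)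
      _ = _ := h1
  · exact Function.ne_iff.2 ⟨b, hi⟩

end LambdaMin

/-! ### Entries of the path Laplacian. -/

section PathLaplacian

variable {n : ℕ} {W : Fin n → Fin n → ℝ}

theorem weightedLaplacian_isSymm {V : Type*} [Fintype V] {G : SimpleGraph V} {W : V → V → ℝ}
    (hW : ∀ i j, G.Adj i j → W i j = W j i) : (weightedLaplacian G W).IsSymm := by
  refine Matrix.IsSymm.ext fun i j => ?_
  unfold weightedLaplacian
  by_cases hij : i = j
  · subst hij
    rfl
  · rw [if_neg hij, if_neg (Ne.symm hij)]
    by_cases ha : G.Adj i j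
    · rw [if_pos ha, if_pos ha.symm, hW i j ha]
    · rw [if_neg ha, if_neg (fun h => ha h.symm)]

theorem weightedLaplacian_pathGraph_eq_zero {i j : Fin n} (hij : i ≠ j)
    (h : ¬ (i.val + 1 = j.val ∨ j.val + 1 = i.val)) :
    weightedLaplacian (SimpleGraph.pathGraph n) W i j = 0 := by
  unfold weightedLaplacian
  rw [if_neg hij, if_neg (by rwa [SimpleGraph.pathGraph_adj])]

theorem weightedLaplacian_pathGraph_succ {p : ℕ} (h : p + 1 < n) :
    weightedLaplacian (SimpleGraph.pathGraph n) W ⟨p, by omega⟩ ⟨p + 1, h⟩ =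
      - W ⟨p, by omega⟩ ⟨p + 1, h⟩ := by
  unfold weightedLaplacian
  rw [if_neg (by simp), if_pos (by simp [SimpleGraph.pathGraph_adj])]

theorem weightedLaplacian_pathGraph_diag {p : ℕ} (h : p < n) :
    weightedLaplacian (SimpleGraph.pathGraph n) W ⟨p, h⟩ ⟨p, h⟩ =
      (if 0 < p then W ⟨p, h⟩ ⟨p - 1, by omega⟩ else 0) +
        (if h' : p + 1 < n then W ⟨p, h⟩ ⟨p + 1, h'⟩ else 0) := by
  classical
  unfold weightedLaplacian
  rw [if_pos rfl]
  have h1 : (Finset.univ.filter fun l => (SimpleGraph.pathGraph n).Adj ⟨p, h⟩ l) =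
      (Finset.univ.filter fun l : Fin n => l.val + 1 = p) ∪
        (Finset.univ.filter fun l : Fin n => p + 1 = l.val) := by
    ext l
    simp [SimpleGraph.pathGraph_adj, or_comm]
  have h2 : Disjoint (Finset.univ.filter fun l : Fin n => l.val + 1 = p)
      (Finset.univ.filter fun l : Fin n => p + 1 = l.val) := by
    rw [Finset.disjoint_filter]
    intros
    omega
  have h3 : ∑ l with (SimpleGraph.pathGraph n).Adj ⟨p, h⟩ l, W ⟨p, h⟩ l =
      ∑ l : Fin n with l.val + 1 = p, W ⟨p, h⟩ l + ∑ l : Fin n with p + 1 = l.val, W ⟨p, h⟩ l := by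
    rw [← Finset.sum_union h2, ← h1]
  refine Eq.trans ?_ (h3.trans ?_)
  -- The two sums differ only in the decidability instance of the filter.
  · congr!
  congr 1
  · split_ifs with hp
    · rw [Finset.sum_eq_single_of_mem ⟨p - 1, by omega⟩ (by simp; omega)]
      intro b hb hb'
      refine absurd (Fin.ext ?_) hb'
      simp at hb ⊢
      omega
    · refine Finset.sum_eq_zero fun b hb => ?_
      simp at hb
      omega
  · split_ifs with hp
    · rw [Finset.sum_eq_single_of_mem ⟨p + 1, hp⟩ (by simp)]
      intro b hb hb'
      refine absurd (Fin.ext ?_) hb'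
      simp at hb ⊢
      omega
    · refine Finset.sum_eq_zero fun b hb => ?_
      simp at hb
      omega

end PathLaplacian

namespace RealRAM

/-! ### Blocks of followers and widest paths in the digraph. -/

section WidestPath

variable {n : ℕ} (W : Fin n → Fin n → ℝ)

/-- The array that holds the Laplacian of the weighted path graph, with indices from `1`. -/
noncomputable def lapArray (p q : ℕ) : EReal :=
  if h : (1 ≤ p ∧ p ≤ n) ∧ (1 ≤ q ∧ q ≤ n) then
    ((weightedLaplacian (SimpleGraph.pathGraph n) W
      ⟨p - 1, by omega⟩ ⟨q - 1, by omega⟩ : ℝ) : EReal)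
  else 0

/-- The weight of the edge `(u, v)` of the digraph. -/
noncomputable def blockWidth (u v : ℕ) : EReal :=
  lambdaMin (tridiagonal (lapArray W) (u + 1) (v - (u + 1)))

/-- The nodes strictly between `u` and `v`. -/
def blockEmb (n u v : ℕ) (hv : v ≤ n + 1) (i : Fin (v - (u + 1))) : Fin n :=
  ⟨u + i, by omega⟩

theorem blockEmb_injective (u v : ℕ) (hv : v ≤ n + 1) :
    Function.Injective (blockEmb n u v hv) := by
  intro i j h
  simp only [blockEmb, Fin.mk.injEq] at h
  exact Fin.ext (by omega)

theorem mem_range_blockEmb {u v : ℕ} (hv : v ≤ n + 1) {i : Fin n} :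
    i ∈ Set.range (blockEmb n u v hv) ↔ u < i.val + 1 ∧ i.val + 1 < v := by
  constructor
  · rintro ⟨a, rfl⟩
    have := a.isLt
    simp only [blockEmb]
    omega
  · rintro ⟨h1, h2⟩
    refine ⟨⟨i - u, by omega⟩, Fin.ext ?_⟩
    simp only [blockEmb]
    omega

theorem tridiagonal_congr {M M' : ℕ → ℕ → EReal} {a m : ℕ}
    (h0 : ∀ i < m, M (a + i) (a + i) = M' (a + i) (a + i))
    (h1 : ∀ i, i + 1 < m → M (a + i) (a + (i + 1)) = M' (a + i) (a + (i + 1))) :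
    tridiagonal M a m = tridiagonal M' a m := by
  funext i j
  unfold tridiagonal
  split_ifs with h2 h3 h4
  · rw [h0 i i.isLt]
  · rw [← h3, h1 i (by omega)]
  · rw [← h4, h1 j (by omega)]
  · rfl

variable {W}

/-- The matrix built from the diagonal and superdiagonal alone is the true block: symmetry supplies
the subdiagonal, and non-neighbours have entry zero. -/
theorem tridiagonal_lapArray (hW : ∀ i j, (SimpleGraph.pathGraph n).Adj i j → W i j = W j i)
    {u v : ℕ} (hv : v ≤ n + 1) :
    tridiagonal (lapArray W) (u + 1) (v - (u + 1)) =
      (weightedLaplacian (SimpleGraph.pathGraph n) W).submatrix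
        (blockEmb n u v hv) (blockEmb n u v hv) := by
  have key (i j : Fin (v - (u + 1))) : (lapArray W (u + 1 + i) (u + 1 + j)).toReal =
      weightedLaplacian (SimpleGraph.pathGraph n) W
        (blockEmb n u v hv i) (blockEmb n u v hv j) := by
    have hi := i.isLt
    have hj := j.isLt
    rw [lapArray, dif_pos (by omega), EReal.toReal_coe]
    congr 1 <;> exact Fin.ext (by simp only [blockEmb]; omega)
  funext i j
  rw [tridiagonal, Matrix.submatrix_apply]
  split_ifs with h1 h2 h3
  · subst h1
    exact key i i
  · exact key i j
  · rw [key j i]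
    exact (weightedLaplacian_isSymm hW).apply _ _
  · rw [weightedLaplacian_pathGraph_eq_zero]
    · exact fun h => h1 (blockEmb_injective u v hv h)
    · simp only [blockEmb]
      omega

theorem convRate_le_blockWidth
    (hW : ∀ i j, (SimpleGraph.pathGraph n).Adj i j → W i j = W j i) {S : Finset (Fin n)}
    {u v : ℕ} (hv : v ≤ n + 1) (hS : ∀ s ∈ S, ¬ (u < s.val + 1 ∧ s.val + 1 < v)) :
    convRate (SimpleGraph.pathGraph n) W S ≤ blockWidth W u v := by
  have hmem (i) : blockEmb n u v hv i ∉ S := fun h =>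
    hS _ h ((mem_range_blockEmb hv).1 ⟨i, rfl⟩)
  rw [blockWidth, tridiagonal_lapArray hW hv]
  refine lambdaMin_le_lambdaMin_submatrix
    (f := fun i => (⟨blockEmb n u v hv i, hmem i⟩ : {w : Fin n // w ∉ S})) ?_ ?_
  · exact (weightedLaplacian_isSymm hW).submatrix _
  · intro i j h
    exact blockEmb_injective u v hv (congrArg Subtype.val h)

/-- The only nodes adjacent to the gap between `u` and `v` are `u` and `v` themselves. Each is a
leader or lies beyond the end of the path, so the gap is uncoupled from the other followers. -/
theorem le_convRate (hW : ∀ i j, (SimpleGraph.pathGraph n).Adj i j → W i j = W j i)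
    {S : Finset (Fin n)} {D : EReal}
    (h : ∀ i ∉ S, ∃ u v, u < i.val + 1 ∧ i.val + 1 < v ∧ v ≤ n + 1 ∧
      (∀ s ∈ S, ¬ (u < s.val + 1 ∧ s.val + 1 < v)) ∧ (u = 0 ∨ ∃ s ∈ S, s.val + 1 = u) ∧
      (v = n + 1 ∨ ∃ s ∈ S, s.val + 1 = v) ∧ D ≤ blockWidth W u v) :
    D ≤ convRate (SimpleGraph.pathGraph n) W S := by
  refine le_lambdaMin_of_blocks ?_
  rintro ⟨i, hi⟩
  obtain ⟨u, v, hui, hiv, hv, hS, hu, hv', hD⟩ := h i hi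
  have hmem (i) : blockEmb n u v hv i ∉ S := fun h =>
    hS _ h ((mem_range_blockEmb hv).1 ⟨i, rfl⟩)
  refine ⟨_, fun i => ⟨blockEmb n u v hv i, hmem i⟩, ?_, ?_, ?_, ?_⟩
  · intro i j h
    exact blockEmb_injective u v hv (congrArg Subtype.val h)
  · obtain ⟨a, ha⟩ := (mem_range_blockEmb hv).2 ⟨hui, hiv⟩
    exact ⟨a, Subtype.ext ha⟩
  · rintro a ⟨j, hj⟩ hja
    have h1 := (mem_range_blockEmb hv).1 ⟨a, rfl⟩
    have h2 : ¬ (u < j.val + 1 ∧ j.val + 1 < v) := fun h => by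
      obtain ⟨b, hb⟩ := (mem_range_blockEmb hv).2 h
      exact hja ⟨b, Subtype.ext hb⟩
    have h3 : j.val + 1 ≠ u := by
      rintro h3
      rcases hu with hu | ⟨s, hs, hu⟩
      · omega
      · exact hj ((Fin.ext (by omega) : s = j) ▸ hs)
    have h4 : j.val + 1 ≠ v := by
      rintro h4
      rcases hv' with hv' | ⟨s, hs, hv'⟩
      · omega
      · exact hj ((Fin.ext (by omega) : s = j) ▸ hs)
    refine weightedLaplacian_pathGraph_eq_zero ?_ ?_
    · intro h
      have : (blockEmb n u v hv a).val = j.val := congrArg Fin.val h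
      omega
    · change ¬ ((blockEmb n u v hv a).val + 1 = j.val ∨ j.val + 1 = (blockEmb n u v hv a).val)
      omega
  · rw [blockWidth, tridiagonal_lapArray hW hv] at hD
    exact hD

theorem convRate_mono (hW : ∀ i j, (SimpleGraph.pathGraph n).Adj i j → W i j = W j i)
    {S T : Finset (Fin n)} (h : S ⊆ T) :
    convRate (SimpleGraph.pathGraph n) W S ≤ convRate (SimpleGraph.pathGraph n) W T := by
  refine lambdaMin_le_lambdaMin_submatrix (A := (weightedLaplacian (SimpleGraph.pathGraph n)
    W).submatrix (fun i : {v : Fin n // v ∉ S} => (i : Fin n)) (fun i => (i : Fin n)))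
    (f := fun i : {v : Fin n // v ∉ T} => (⟨i, fun hi => i.2 (h hi)⟩ : {v : Fin n // v ∉ S}))
    ?_ ?_
  · exact (weightedLaplacian_isSymm hW).submatrix _
  · intro i j h
    exact Subtype.ext (congrArg (fun x : {v : Fin n // v ∉ S} => (x : Fin n)) h)

/-- The first predecessor of the node `v` in the digraph. -/
def firstPred (n v : ℕ) : ℕ := if v = n + 1 then 1 else 0

variable (W) in
/-- The largest width of a path of `m` edges from the source to `v`. -/
noncomputable def widest : ℕ → ℕ → EReal
  | 0, v => if v = 0 then ⊤ else ⊥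
  | m + 1, v => (Finset.Ico (firstPred n v) v).sup fun u => min (widest m u) (blockWidth W u v)

theorem le_widest_succ {m u v : ℕ} (h1 : firstPred n v ≤ u) (h2 : u < v) :
    min (widest W m u) (blockWidth W u v) ≤ widest W (m + 1) v :=
  Finset.le_sup (f := fun u => min (widest W m u) (blockWidth W u v))
    (Finset.mem_Ico.2 ⟨h1, h2⟩)

theorem widest_zero_target : widest W 0 (n + 1) = ⊥ := by
  simp [widest]

/-- Here the exclusion of the edge `(s, t)` enters; it forces the chosen path to have at least two
edges. -/
theorem widest_one_target : widest W 1 (n + 1) = ⊥ := by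
  rw [widest, Finset.sup_eq_bot_iff]
  intro u hu
  rw [Finset.mem_Ico, firstPred, if_pos rfl] at hu
  rw [widest, if_neg (by omega), min_eq_left bot_le]

/-- The leaders themselves form a path from `s` to `t` with `S.card + 1` edges, each at least as
wide as `C(S)`. For empty `S` this would be the missing edge `(s, t)`. -/
theorem convRate_le_widest_of_card_eq
    (hW : ∀ i j, (SimpleGraph.pathGraph n).Adj i j → W i j = W j i) {S : Finset (Fin n)}
    (hS : S.Nonempty) :
    convRate (SimpleGraph.pathGraph n) W S ≤ widest W (S.card + 1) (n + 1) := by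
  classical
  set T : Finset ℕ := insert 0 (S.image fun i => i.val + 1) with hT
  have memT (x : ℕ) : x ∈ T ↔ x = 0 ∨ ∃ s ∈ S, s.val + 1 = x := by simp [hT]
  have hlt (x) (hx : x ∈ T) : x < n + 1 := by
    rcases (memT x).1 hx with h | ⟨s, -, h⟩ <;> omega
  -- Induction along the sorted nodes: the predecessor of `v` is the largest element `u` of `T`
  -- below `v`, and one element fewer lies below `u`. The count is thus the number of edges used.
  have key (v : ℕ) : (v ∈ T ∨ v = n + 1) →
      convRate (SimpleGraph.pathGraph n) W S ≤ widest W (T.filter (· < v)).card v := by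
    induction v using Nat.strong_induction_on with
    | _ v ih =>
      intro hv
      rcases Nat.eq_zero_or_pos v with rfl | hpos
      · simp [widest]
      have hne : (T.filter (· < v)).Nonempty := ⟨0, by simp [memT, hpos]⟩
      obtain ⟨u, hu, hmax⟩ : ∃ u ∈ T.filter (· < v), ∀ x ∈ T.filter (· < v), x ≤ u :=
        ⟨_, Finset.max'_mem _ hne, fun x hx => Finset.le_max' _ x hx⟩
      rw [Finset.mem_filter] at hu
      have hins : T.filter (· < v) = insert u (T.filter (· < u)) := by
        ext x
        rw [Finset.mem_insert, Finset.mem_filter, Finset.mem_filter]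
        constructor
        · rintro h
          have := hmax x (Finset.mem_filter.2 h)
          rcases this.eq_or_lt with h' | h'
          · exact Or.inl h'
          · exact Or.inr ⟨h.1, h'⟩
        · rintro (rfl | h)
          · exact hu
          · exact ⟨h.1, h.2.trans hu.2⟩
      rw [hins, Finset.card_insert_of_notMem (by simp)]
      refine le_trans (le_min (ih u hu.2 (Or.inl hu.1)) ?_) (le_widest_succ ?_ hu.2)
      · refine convRate_le_blockWidth hW ?_ ?_
        · rcases hv with hv | hv
          · exact (hlt v hv).le
          · exact hv.le
        · rintro s hs ⟨h1, h2⟩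
          have := hmax (s + 1) (Finset.mem_filter.2 ⟨(memT _).2 (Or.inr ⟨s, hs, rfl⟩), h2⟩)
          omega
      · rw [firstPred]
        split_ifs with h
        · obtain ⟨s, hs⟩ := hS
          have := hmax (s + 1) (Finset.mem_filter.2
            ⟨(memT _).2 (Or.inr ⟨s, hs, rfl⟩), by omega⟩)
          omega
        · exact Nat.zero_le _
  have hcard : (T.filter (· < n + 1)).card = S.card + 1 := by
    rw [Finset.filter_true_of_mem hlt, hT, Finset.card_insert_of_notMem (by simp),
      Finset.card_image_of_injective _ (fun i j h => Fin.ext (by simpa using h))]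
  rw [← hcard]
  exact key (n + 1) (Or.inr rfl)

/-- `widest` counts edges exactly, so a smaller set is first enlarged to `k` leaders, which is
possible because `k ≤ n`. -/
theorem convRate_le_widest (hW : ∀ i j, (SimpleGraph.pathGraph n).Adj i j → W i j = W j i)
    {k : ℕ} (hk : 1 ≤ k) (hkn : k ≤ n) {S : Finset (Fin n)} (hS : S.card ≤ k) :
    convRate (SimpleGraph.pathGraph n) W S ≤ widest W (k + 1) (n + 1) := by
  obtain ⟨T, hST, hT⟩ := Finset.exists_superset_card_eq hS (by simpa using hkn)
  rw [← hT]
  exact (convRate_mono hW hST).trans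
    (convRate_le_widest_of_card_eq hW (Finset.card_pos.1 (by omega)))

theorem widest_ne_bot (hW : ∀ i j, (SimpleGraph.pathGraph n).Adj i j → W i j = W j i)
    {k : ℕ} (hk : 1 ≤ k) (hkn : k ≤ n) : widest W (k + 1) (n + 1) ≠ ⊥ := by
  intro h
  have := convRate_le_widest hW hk hkn (S := ∅) (by simp)
  rw [h, le_bot_iff] at this
  exact lambdaMin_ne_bot _ this

/-- The path is listed backwards from `t` to `s`; every follower lies in the gap between two
successive entries, whose block has width at least `D`. -/
theorem le_convRate_of_path (hW : ∀ i j, (SimpleGraph.pathGraph n).Adj i j → W i j = W j i)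
    {l : ℕ} {D : EReal} {q : ℕ → ℕ} (h0 : q 0 = n + 1) (hl : q l = 0)
    (hq : ∀ j < l, q (j + 1) < q j ∧ D ≤ blockWidth W (q (j + 1)) (q j))
    {S : Finset (Fin n)} (hS : ∀ i : Fin n, i ∈ S ↔ ∃ j < l, q j = i.val + 1) :
    D ≤ convRate (SimpleGraph.pathGraph n) W S ∧ S.card ≤ l - 1 := by
  have anti (a b : ℕ) (hab : a ≤ b) (hb : b ≤ l) : q b ≤ q a := by
    induction b, hab using Nat.le_induction with
    | base => exact le_rfl
    | succ b _ ih => exact (hq b (by omega)).1.le.trans (ih (by omega))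
  have hin (j) (h1 : 1 ≤ j) (h2 : j < l) : ∃ s ∈ S, s.val + 1 = q j := by
    have h3 := (hq j h2).1
    have h4 : q 1 < q 0 := (hq 0 (by omega)).1
    have h5 := anti 1 j h1 h2.le
    refine ⟨⟨q j - 1, by omega⟩, (hS _).2 ⟨j, h2, ?_⟩, ?_⟩ <;> simp only <;> omega
  constructor
  · refine le_convRate hW fun i hi => ?_
    -- The follower `i` has number `i + 1`, so the first such `j` gives the first path node strictly
    -- below it.
    have hex : ∃ j, j ≤ l ∧ q j ≤ i := ⟨l, le_rfl, by omega⟩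
    classical
    obtain ⟨hjl, hji⟩ := Nat.find_spec hex
    have hmin (j) (hj : j < Nat.find hex) : i.val < q j := by
      by_contra h
      exact Nat.find_min hex hj ⟨by omega, by omega⟩
    obtain ⟨j, hj⟩ : ∃ j, Nat.find hex = j + 1 := by
      refine Nat.exists_eq_succ_of_ne_zero fun h => ?_
      rw [h] at hji
      omega
    rw [hj] at hjl hji hmin
    have hlt := hmin j (by omega)
    have hne : q j ≠ i + 1 := fun h => hi ((hS i).2 ⟨j, hjl, h⟩)
    refine ⟨q (j + 1), q j, by omega, by omega, ?_, ?_, ?_, ?_, (hq j hjl).2⟩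
    · rw [← h0]
      exact anti 0 j (Nat.zero_le _) (by omega)
    · rintro s hs ⟨h1, h2⟩
      obtain ⟨a, hal, ha⟩ := (hS s).1 hs
      rcases Nat.lt_or_ge j a with h | h
      · have := anti (j + 1) a h hal.le
        omega
      · have := anti a j h (by omega)
        omega
    · rcases hjl.eq_or_lt with h | h
      · exact Or.inl ((congrArg q h).trans hl)
      · exact Or.inr (hin (j + 1) (by omega) h)
    · rcases Nat.eq_zero_or_pos j with h | h
      · exact Or.inl (h ▸ h0)
      · exact Or.inr (hin j h hjl)
  · classical
    calc S.card = (S.image fun i => i.val + 1).card :=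
          (Finset.card_image_of_injective _ (fun i j h => Fin.ext (by simpa using h))).symm
      -- Index `0` contributes nothing, because `q 0 = n + 1` is the target.
      _ ≤ ((Finset.Icc 1 (l - 1)).image q).card := by
          refine Finset.card_le_card fun x hx => ?_
          obtain ⟨i, hi, rfl⟩ := Finset.mem_image.1 hx
          obtain ⟨j, hjl, hj⟩ := (hS i).1 hi
          refine Finset.mem_image.2 ⟨j, Finset.mem_Icc.2 ⟨?_, by omega⟩, hj⟩
          rcases Nat.eq_zero_or_pos j with rfl | h
          · omega
          · exact h
      _ ≤ _ := Finset.card_image_le.trans (by simp)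

variable (W) in
/-- `p` is the last but one node of a widest path of `m` edges to `v`. -/
def IsPred (m v p : ℕ) : Prop :=
  p < v ∧ widest W m v ≤ min (widest W (m - 1) p) (blockWidth W p v)

/-- Going back along predecessors, the remaining initial part keeps width at least that of the
optimum. As this is not `⊥`, every table entry that is consulted is valid. -/
theorem le_convRate_of_isPred (hW : ∀ i j, (SimpleGraph.pathGraph n).Adj i j → W i j = W j i)
    {l : ℕ} (hl : 1 ≤ l) (hD : widest W l (n + 1) ≠ ⊥) {pre : ℕ → ℕ → ℕ}
    (hpre : ∀ m v, 1 ≤ m → m ≤ l → v ≤ n + 1 → widest W m v ≠ ⊥ → IsPred W m v (pre m v))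
    {q : ℕ → ℕ} (h0 : q 0 = n + 1) (hq : ∀ j, j + 1 < l → q (j + 1) = pre (l - j) (q j))
    {S : Finset (Fin n)} (hS : ∀ i : Fin n, i ∈ S ↔ ∃ j < l, q j = i.val + 1) :
    widest W l (n + 1) ≤ convRate (SimpleGraph.pathGraph n) W S ∧ S.card ≤ l - 1 := by
  have hstep (j) (hj : j < l) (h1 : q j ≤ n + 1) (h2 : widest W l (n + 1) ≤ widest W (l - j) (q j)) :
      pre (l - j) (q j) < q j ∧
        widest W l (n + 1) ≤ widest W (l - (j + 1)) (pre (l - j) (q j)) ∧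
        widest W l (n + 1) ≤ blockWidth W (pre (l - j) (q j)) (q j) := by
    obtain ⟨h3, h4⟩ := hpre (l - j) (q j) (by omega) (by omega) h1
      (fun h => hD (le_bot_iff.1 (h ▸ h2)))
    have h5 := le_min_iff.1 (h2.trans h4)
    rw [Nat.sub_sub] at h5
    exact ⟨h3, h5⟩
  have hinv (j) (hj : j < l) :
      q j ≤ n + 1 ∧ widest W l (n + 1) ≤ widest W (l - j) (q j) := by
    induction j with
    | zero => simp [h0]
    | succ j ih =>
      obtain ⟨h1, h2⟩ := ih (by omega)
      obtain ⟨h3, h4, -⟩ := hstep j (by omega) h1 h2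
      rw [hq j hj]
      exact ⟨by omega, h4⟩
  -- Only the entries before `l` are prescribed; the source is put in by hand at index `l`.
  refine le_convRate_of_path hW (q := fun j => if j < l then q j else 0) (l := l) ?_ ?_ ?_ ?_
  · simp [h0]
    omega
  · simp
  · intro j hj
    obtain ⟨h1, h2⟩ := hinv j hj
    obtain ⟨h3, h4, h5⟩ := hstep j hj h1 h2
    have h6 : (if j + 1 < l then q (j + 1) else 0) = pre (l - j) (q j) := by
      split_ifs with h
      · exact hq j h
      -- With no edges left, any node other than the source has width `⊥`, so the last predecessor
      -- is `0`.
      · by_contra hne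
        rw [show l - (j + 1) = 0 by omega, widest, if_neg (Ne.symm hne), le_bot_iff] at h4
        exact hD h4
    simp only [h6, if_pos hj]
    exact ⟨h3, h5⟩
  · intro i
    rw [hS]
    refine exists_congr fun j => and_congr_right fun hj => ?_
    rw [if_pos hj]

end WidestPath

/-! ### A program logic with operation counts. -/

section Runs

variable {κ : ℕ} {σ : Store} {Q : Store → Prop} {N : ℕ}

/-- The command `c`, started in `σ`, ends in a store that satisfies `Q` after at most `N`
operations. -/
def Runs (κ : ℕ) (c : Cmd) (σ : Store) (Q : Store → Prop) (N : ℕ) : Prop :=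
  Q (exec κ c σ).1 ∧ (exec κ c σ).2 ≤ N

theorem Runs.mono {c : Cmd} {Q' : Store → Prop} {N' : ℕ} (h : Runs κ c σ Q N)
    (hQ : ∀ τ, Q τ → Q' τ) (hN : N ≤ N') : Runs κ c σ Q' N' :=
  ⟨hQ _ h.1, h.2.trans hN⟩

theorem Runs.skip (h : Q σ) (hN : 1 ≤ N) : Runs κ .skip σ Q N := ⟨h, hN⟩

theorem Runs.seq {c₁ c₂ : Cmd} {P : Store → Prop} {N₁ N₂ : ℕ} (h₁ : Runs κ c₁ σ P N₁)
    (h₂ : ∀ τ, P τ → Runs κ c₂ τ Q N₂) (hN : N₁ + N₂ ≤ N) : Runs κ (c₁ ;; c₂) σ Q N :=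
  ⟨(h₂ _ h₁.1).1, (Nat.add_le_add h₁.2 (h₂ _ h₁.1).2).trans hN⟩

theorem Runs.setN {r : NVar} {a : NExp} (h : Q (σ.setNat r (a.eval σ))) (hN : a.cost + 1 ≤ N) :
    Runs κ (.setN r a) σ Q N := ⟨h, hN⟩

theorem Runs.putN {A : NArr} {p q a : NExp}
    (h : Q (σ.setNArr A (p.eval σ) (q.eval σ) (a.eval σ)))
    (hN : p.cost + q.cost + a.cost + 1 ≤ N) : Runs κ (.putN A p q a) σ Q N := ⟨h, hN⟩

theorem Runs.putR {A : RArr} {p q : NExp} {x : RExp}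
    (h : Q (σ.setRArr A (p.eval σ) (q.eval σ) (x.eval σ)))
    (hN : p.cost + q.cost + x.cost + 1 ≤ N) : Runs κ (.putR A p q x) σ Q N := ⟨h, hN⟩

theorem Runs.ite {p : BExp} {c₁ c₂ : Cmd} {M : ℕ} (h₁ : p.holds σ → Runs κ c₁ σ Q M)
    (h₂ : ¬ p.holds σ → Runs κ c₂ σ Q M) (hN : p.cost + 1 + M ≤ N) :
    Runs κ (.ite p c₁ c₂) σ Q N := by
  unfold Runs
  rw [exec]
  split_ifs with h
  · exact ⟨(h₁ h).1, (Nat.add_le_add_left (h₁ h).2 _).trans hN⟩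
  · exact ⟨(h₂ h).1, (Nat.add_le_add_left (h₂ h).2 _).trans hN⟩

theorem rounds_spec {f : ℕ → Store → Store × ℕ} {I : ℕ → Store → Prop} {a M : ℕ} (m : ℕ)
    (h0 : I a σ)
    (hstep : ∀ x τ, a ≤ x → x < a + m → I x τ → I (x + 1) (f x τ).1 ∧ (f x τ).2 ≤ M) :
    I (a + m) (rounds f a m σ).1 ∧ (rounds f a m σ).2 ≤ m * (M + 1) := by
  induction m with
  | zero => exact ⟨h0, by simp [rounds]⟩
  | succ m ih =>
    obtain ⟨h1, h2⟩ := ih fun x τ hx hx' => hstep x τ hx (by omega)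
    obtain ⟨h3, h4⟩ := hstep (a + m) _ (by omega) (by omega) h1
    refine ⟨h3, ?_⟩
    rw [rounds, Nat.succ_mul]
    simp only
    omega

/-- The rule for a loop of at most `3 * n` rounds with the invariant `I`. -/
theorem Runs.loop {n d c C : ℕ} (I : ℕ → Store → Prop) (A B : ℕ) {r : NVar} {a b : NExp}
    {body : Cmd} (ha : a.eval σ = A) (hb : b.eval σ = B) (hAB : A ≤ B) (hn : 1 ≤ n)
    (hB : B ≤ 3 * n) (h0 : I A σ)
    (hstep : ∀ x τ, A ≤ x → x < B → I x τ →
      Runs κ body (τ.setNat r x) (I (x + 1)) (c * n ^ d))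
    (hC : a.cost + b.cost + 1 + 3 * (c + 1) ≤ C) :
    Runs κ (.loop r a b body) σ (I B) (C * n ^ (d + 1)) := by
  subst ha hb
  have h := rounds_spec (σ := σ) (f := fun x τ => exec κ body (τ.setNat r x))
    (b.eval σ - a.eval σ) h0
    (fun x τ h1 h2 h3 => hstep x τ h1 (by omega) h3)
  rw [Nat.add_sub_cancel' hAB] at h
  refine ⟨h.1, ?_⟩
  have h1 : 1 ≤ n ^ d := Nat.one_le_pow _ _ hn
  have h2 : 1 ≤ n ^ (d + 1) := Nat.one_le_pow _ _ hn
  -- The factor `3` suffices for every loop of the program, since the largest upper bound is `n + 2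
  -- ≤ 3 * n`.
  have h3 : (b.eval σ - a.eval σ) * (c * n ^ d + 1) ≤ 3 * (c + 1) * n ^ (d + 1) :=
    calc (b.eval σ - a.eval σ) * (c * n ^ d + 1)
        ≤ (3 * n) * (c * n ^ d + n ^ d) := Nat.mul_le_mul (by omega) (by omega)
      _ = _ := by ring
  calc (exec κ (.loop r a b body) σ).2
      ≤ (a.cost + b.cost + 1) * 1 + 3 * (c + 1) * n ^ (d + 1) := by
        rw [exec, mul_one]
        exact Nat.add_le_add_left (h.2.trans h3) _
    _ ≤ (a.cost + b.cost + 1) * n ^ (d + 1) + 3 * (c + 1) * n ^ (d + 1) := by gcongr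
    _ = (a.cost + b.cost + 1 + 3 * (c + 1)) * n ^ (d + 1) := by ring
    _ ≤ _ := Nat.mul_le_mul_right _ hC

end Runs

/-! ### Correctness and cost of the phases of the program. -/

section Phases

variable {κ n k : ℕ} {W : Fin n → Fin n → ℝ}

theorem input_weight {p q : ℕ} (hp : 1 ≤ p ∧ p ≤ n) (hq : 1 ≤ q ∧ q ≤ n) :
    (input n k W).rarr .weight p q =
      ((W ⟨p - 1, by omega⟩ ⟨q - 1, by omega⟩ : ℝ) : EReal) := by
  simp [input, hp, hq]

/-- The summands stand in the order in which the program accumulates them, starting from the cleared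
cell. -/
theorem lapArray_diag {i : ℕ} (h1 : 1 ≤ i) (h2 : i ≤ n) :
    lapArray W i i = 0 + (if 1 < i then (input n k W).rarr .weight i (i - 1) else 0) +
      (if i < n then (input n k W).rarr .weight i (i + 1) else 0) := by
  rw [lapArray, dif_pos (by omega), weightedLaplacian_pathGraph_diag, zero_add, EReal.coe_add]
  congr 1
  · by_cases h : 1 < i
    · rw [if_pos h, if_pos (by omega), input_weight (by omega) (by omega)]
    · rw [if_neg h, if_neg (by omega), EReal.coe_zero]
  · by_cases h : i < n
    · rw [if_pos h, dif_pos (by omega), input_weight (by omega) (by omega)]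
      congr 3
      omega
    · rw [if_neg h, dif_neg (by omega), EReal.coe_zero]

theorem lapArray_succ {i : ℕ} (h1 : 1 ≤ i) (h2 : i < n) :
    lapArray W i (i + 1) = - (input n k W).rarr .weight i (i + 1) := by
  rw [lapArray, dif_pos (by omega), input_weight (by omega) (by omega), ← EReal.coe_neg]
  congr 1
  obtain ⟨p, rfl⟩ : ∃ p, i = p + 1 := ⟨i - 1, by omega⟩
  exact weightedLaplacian_pathGraph_succ h2

/-- The diagonal and the superdiagonal of `M` agree with the Laplacian in the rows below `i`. -/
def LapRows (W : Fin n → Fin n → ℝ) (M : ℕ → ℕ → EReal) (i : ℕ) : Prop :=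
  (∀ p, 1 ≤ p → p ≤ n → p < i → M p p = lapArray W p p) ∧
    ∀ p, 1 ≤ p → p < n → p < i → M p (p + 1) = lapArray W p (p + 1)

theorem runs_buildLaplacian (hn : 1 ≤ n) :
    Runs κ buildLaplacian (input n k W)
      (fun τ => τ.nat .n = n ∧ τ.nat .k = k ∧ LapRows W (τ.rarr .lap) (n + 1))
      (500 * n ^ 2) := by
  refine (Runs.loop (n := n) (d := 1) (c := 100) (C := 400) (fun i τ => τ.nat .n = n ∧
    τ.nat .k = k ∧ τ.rarr .weight = (input n k W).rarr .weight ∧ LapRows W (τ.rarr .lap) i)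
    1 (n + 1) rfl rfl (by omega) hn (by omega) ?_ ?_ (by decide)).mono ?_ (by gcongr; omega)
  · exact ⟨rfl, rfl, rfl, fun p _ _ _ => by omega, fun p _ _ _ => by omega⟩
  · rintro i σ hi1 hi2 ⟨hσn, hσk, hσw, hσd, hσs⟩
    refine Runs.seq (N₁ := 20 * n ^ (0 + 1)) (N₂ := 80)
      (Runs.loop (n := n) (d := 0) (c := 4) (C := 20) (fun j τ => τ.nat .n = n ∧
        τ.nat .k = k ∧ τ.nat .i = i ∧ τ.rarr .weight = (input n k W).rarr .weight ∧
        -- Of row `i`, only the diagonal cell has to be known as cleared, because the program adds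
        -- to it; the superdiagonal cell is overwritten.
        LapRows W (τ.rarr .lap) i ∧ (i < j → τ.rarr .lap i i = 0))
        1 (n + 1) rfl (by simp [NExp.eval, Store.setNat, hσn]) (by omega) hn (by omega)
        ?_ ?_ (by decide)) ?_ ?_
    · exact ⟨hσn, hσk, rfl, hσw, ⟨hσd, hσs⟩, by omega⟩
    · rintro j τ hj1 hj2 ⟨hn', hk', hi', hw', ⟨hd', hs'⟩, h0'⟩
      refine Runs.putR ?_ (by simp [NExp.cost, RExp.cost])
      have e1 : ∀ p q, (((τ.setNat .j j).setRArr .lap i j 0).rarr .lap p q) =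
          if p = i ∧ q = j then 0 else τ.rarr .lap p q := fun p q => by
        simp [Store.setNat, Store.setRArr]
      simp only [NExp.eval, RExp.eval]
      rw [show (τ.setNat .j j).nat .i = i from hi', show (τ.setNat .j j).nat .j = j from rfl]
      refine ⟨hn', hk', hi', ?_, ⟨?_, ?_⟩, ?_⟩
      · rw [← hw']
        funext p q
        simp [Store.setRArr, Store.setNat]
      · intro p h1 h2 h3
        rw [e1, if_neg (by omega)]
        exact hd' p h1 h2 h3
      · intro p h1 h2 h3
        rw [e1, if_neg (by omega)]
        exact hs' p h1 h2 h3
      · intro h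
        rw [e1]
        split_ifs with h4
        · rfl
        · exact h0' (by omega)
    · rintro τ ⟨hn', hk', hi', hw', ⟨hd', hs'⟩, h0'⟩
      have h0'' := h0' hi2
      refine Runs.seq (N₁ := 40) (N₂ := 40) (P := fun τ => τ.nat .n = n ∧
        τ.nat .k = k ∧ τ.nat .i = i ∧ τ.rarr .weight = (input n k W).rarr .weight ∧
        LapRows W (τ.rarr .lap) i ∧ τ.rarr .lap i i =
          0 + if 1 < i then (input n k W).rarr .weight i (i - 1) else 0) ?_ ?_ le_rfl
      · refine Runs.ite (M := 30) (fun h => ?_) (fun h => ?_) (by decide)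
        · have h : 1 < i := by simpa [BExp.holds, NExp.eval, hi'] using h
          refine Runs.seq (N₁ := 15) (N₂ := 15) (Runs.putR rfl (by decide)) ?_ le_rfl
          rintro _ rfl
          refine Runs.putR ?_ (by decide)
          refine ⟨hn', hk', hi', ?_, ⟨?_, ?_⟩, ?_⟩
          · rw [← hw']
            funext p q
            simp [Store.setRArr]
          · intro p h1 h2 h3
            rw [← hd' p h1 h2 h3]
            have : p ≠ i := by omega
            simp [Store.setRArr, NExp.eval, hi', this]
          · intro p h1 h2 h3
            rw [← hs' p h1 h2 h3]
            have : p ≠ i := by omega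
            simp [Store.setRArr, NExp.eval, hi', this]
          · rw [if_pos h, ← hw']
            simp [Store.setRArr, NExp.eval, RExp.eval, hi', h0'']
            omega
        · have h : ¬ 1 < i := by simpa [BExp.holds, NExp.eval, hi'] using h
          exact Runs.skip ⟨hn', hk', hi', hw', ⟨hd', hs'⟩, by rw [if_neg h, h0'', add_zero]⟩
            (by decide)
      · clear! τ
        rintro τ ⟨hn', hk', hi', hw', ⟨hd', hs'⟩, h0'⟩
        refine Runs.ite (M := 30) (fun h => ?_) (fun h => ?_) (by decide)
        · have h : i < n := by simpa [BExp.holds, NExp.eval, hi', hn'] using h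
          refine Runs.seq (N₁ := 15) (N₂ := 15) (Runs.putR rfl (by decide)) ?_ le_rfl
          rintro _ rfl
          refine Runs.putR ?_ (by decide)
          refine ⟨hn', hk', ?_, ⟨?_, ?_⟩⟩
          · rw [← hw']
            funext p q
            simp [Store.setRArr]
          · intro p h1 h2 h3
            rcases Nat.lt_succ_iff_lt_or_eq.1 h3 with h3 | rfl
            · rw [← hd' p h1 h2 h3]
              have : p ≠ i := by omega
              simp [Store.setRArr, NExp.eval, hi', this]
            · rw [lapArray_diag (k := k) h1 h2, if_pos h, ← h0', ← hw']
              simp [Store.setRArr, NExp.eval, RExp.eval, hi']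
          · intro p h1 h2 h3
            rcases Nat.lt_succ_iff_lt_or_eq.1 h3 with h3 | rfl
            · rw [← hs' p h1 h2 h3]
              have : p ≠ i := by omega
              simp [Store.setRArr, NExp.eval, hi', this]
            · rw [lapArray_succ (k := k) h1 h, ← hw']
              simp [Store.setRArr, NExp.eval, RExp.eval, hi']
        · have h : ¬ i < n := by simpa [BExp.holds, NExp.eval, hi', hn'] using h
          refine Runs.skip ⟨hn', hk', hw', ⟨?_, ?_⟩⟩ (by decide)
          · intro p h1 h2 h3
            rcases Nat.lt_succ_iff_lt_or_eq.1 h3 with h3 | rfl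
            · exact hd' p h1 h2 h3
            · rw [lapArray_diag (k := k) h1 h2, if_neg h, ← h0', add_zero]
          · intro p h1 h2 h3
            exact hs' p h1 h2 (by omega)
    · rw [zero_add, pow_one]
      omega
  · rintro τ ⟨h1, h2, -, h3⟩
    exact ⟨h1, h2, h3⟩

/-- The array `M` holds the weights of the digraph. -/
def IsWidth (W : Fin n → Fin n → ℝ) (M : ℕ → ℕ → EReal) : Prop :=
  ∀ u v, u < v → v ≤ n + 1 → ¬ (u = 0 ∧ v = n + 1) → M u v = blockWidth W u v

/-- A block has at most `n` rows, so one eigenvalue costs at most `κ * n`; the two loops multiply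
the coefficient `κ` by `3` each, whence `9 * κ`. -/
theorem runs_buildDigraph (hn : 1 ≤ n) {σ : Store} (hσn : σ.nat .n = n) (hσk : σ.nat .k = k)
    (hσl : LapRows W (σ.rarr .lap) (n + 1)) :
    Runs κ buildDigraph σ
      (fun τ => τ.nat .n = n ∧ τ.nat .k = k ∧ IsWidth W (τ.rarr .width))
      ((400 + 9 * κ) * n ^ 3) := by
  refine (Runs.loop (n := n) (d := 2) (c := 120 + 3 * κ) (C := 400 + 9 * κ) (fun u τ =>
    τ.nat .n = n ∧ τ.nat .k = k ∧ LapRows W (τ.rarr .lap) (n + 1) ∧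
    ∀ a b, a < u → a < b → b ≤ n + 1 → ¬ (a = 0 ∧ b = n + 1) →
      τ.rarr .width a b = blockWidth W a b)
    0 (n + 1) rfl (by simp [NExp.eval, target, hσn]) (by omega) hn (by omega) ?_ ?_ ?_).mono ?_
    le_rfl
  · exact ⟨hσn, hσk, hσl, by omega⟩
  · rintro u τ - hu ⟨hn', hk', hl', hw'⟩
    refine (Runs.loop (n := n) (d := 1) (c := 30 + κ) (C := 120 + 3 * κ) (fun v τ =>
      τ.nat .n = n ∧ τ.nat .k = k ∧ τ.nat .u = u ∧ LapRows W (τ.rarr .lap) (n + 1) ∧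
      ∀ a b, (a < u ∨ a = u ∧ b < v) → a < b → b ≤ n + 1 → ¬ (a = 0 ∧ b = n + 1) →
        τ.rarr .width a b = blockWidth W a b)
      (u + 1) (n + 2) (by simp [NExp.eval, Store.setNat])
      (by simp [NExp.eval, target, Store.setNat, hn'])
      (by omega) hn (by omega) ?_ ?_ ?_).mono ?_ le_rfl
    · exact ⟨hn', hk', rfl, hl', fun a b h1 h2 h3 h4 => hw' a b (by omega) h2 h3 h4⟩
    · clear! τ
      rintro v τ hv1 hv2 ⟨hn', hk', hu', hl', hw'⟩
      have step (x : EReal) (hx : ¬ (u = 0 ∧ v = n + 1) → x = blockWidth W u v) :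
          ∀ a b, (a < u ∨ a = u ∧ b < v + 1) → a < b → b ≤ n + 1 → ¬ (a = 0 ∧ b = n + 1) →
            ((τ.setNat .v v).setRArr .width u v x).rarr .width a b = blockWidth W a b := by
        intro a b h1 h2 h3 h4
        by_cases h5 : a = u ∧ b = v
        · obtain ⟨rfl, rfl⟩ := h5
          simpa [Store.setRArr] using hx h4
        · rw [← hw' a b (by omega) h2 h3 h4]
          simp [Store.setRArr, Store.setNat, h5]
      have e1 : (τ.setNat .v v).nat .u = u := hu'
      have e2 : (τ.setNat .v v).nat .n = n := hn'
      have e3 : (τ.setNat .v v).nat .v = v := rfl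
      have hlap (x : EReal) : ((τ.setNat .v v).setRArr .width u v x).rarr .lap = τ.rarr .lap := by
        funext p q
        simp [Store.setRArr, Store.setNat]
      have hN : 15 + 15 + κ * n ≤ (30 + κ) * n := by
        rw [Nat.add_mul]
        omega
      refine Runs.ite (M := 15 + κ * n + 5) (fun h => ?_) (fun h => ?_) ?_
      · have h : v = u + 1 := by simpa [BExp.holds, NExp.eval, e1, e3] using h
        refine Runs.putR ?_ ?_
        · simp only [NExp.eval, RExp.eval, e1, e3]
          refine ⟨hn', hk', hu', ?_, step _ ?_⟩
          · rwa [hlap]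
          · intro _
            -- The block is `0 × 0` and has no eigenvectors, so its width is `⊤`, the value written.
            rw [blockWidth, lambdaMin]
            refine le_antisymm (le_sInf ?_) le_top
            rintro _ ⟨μ, hμ, -⟩
            obtain ⟨y, hy⟩ := hμ.exists_hasEigenvector
            refine absurd (funext fun i => ?_) hy.2
            exact absurd i.isLt (by omega)
        · simp [NExp.cost, RExp.cost]
      · have h : v ≠ u + 1 := by simpa [BExp.holds, NExp.eval, e1, e3] using h
        refine Runs.ite (M := 10 + κ * n) (fun h' => ?_) (fun h' => ?_) ?_
        · have h' : u = 0 ∧ v = n + 1 := by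
            simpa [BExp.holds, NExp.eval, e1, e2, e3, target] using h'
          exact Runs.skip ⟨hn', hk', hu', hl', fun a b h1 h2 h3 h4 =>
            hw' a b (by omega) h2 h3 h4⟩ (by omega)
        · have hlt : tridiagonal ((τ.setNat .v v).rarr .lap) (u + 1) (v - (u + 1)) =
              tridiagonal (lapArray W) (u + 1) (v - (u + 1)) :=
            tridiagonal_congr (fun i hi => hl'.1 _ (by omega) (by omega) (by omega))
              (fun i hi => hl'.2 _ (by omega) (by omega) (by omega))
          refine ⟨?_, ?_⟩
          · simp only [exec, NExp.eval, e1, e3]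
            refine ⟨hn', hk', hu', ?_, step _ ?_⟩
            · rwa [hlap]
            · intro _
              -- Quantifying over `a` and `b` allows rewriting the size of the matrix, on which its
              -- type depends.
              have key (a b : ℕ) (ha : a = u) (hb : b = v) :
                  lambdaMin (tridiagonal ((τ.setNat .v v).rarr .lap) (u + 1) (b - (a + 1))) =
                    blockWidth W u v := by
                rw [ha, hb, blockWidth, hlt]
              exact key _ _ e1 e3
          · simp only [exec, NExp.eval, e1, e3, NExp.cost]
            have : κ * (v - (u + 1)) ≤ κ * n := Nat.mul_le_mul_left _ (by omega)
            omega
        · simp [BExp.cost, NExp.cost, target]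
          omega
      · simp [BExp.cost, NExp.cost]
        omega
    · simp [NExp.cost, target]
      omega
    · rintro τ ⟨h1, h2, h3, h4, h5⟩
      exact ⟨h1, h2, h4, fun a b h6 h7 h8 h9 => h5 a b (by omega) h7 h8 h9⟩
  · simp [NExp.cost, target]
    omega
  · rintro τ ⟨h1, h2, h3, h4⟩
    exact ⟨h1, h2, fun a b h6 h7 h8 => h4 a b (by omega) h6 h7 h8⟩

variable {h : ℕ}

theorem runs_initBellmanFord (hn : 1 ≤ n) (hh : h ≤ n + 1) {σ : Store} (hσn : σ.nat .n = n)
    (hσh : σ.nat .h = h) (hσw : IsWidth W (σ.rarr .width)) :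
    Runs κ initBellmanFord σ
      (fun τ => τ.nat .n = n ∧ τ.nat .h = h ∧ IsWidth W (τ.rarr .width) ∧
        ∀ m v, m ≤ h → v ≤ n + 1 → τ.rarr .dist m v = if m = 0 ∧ v = 0 then ⊤ else ⊥)
      (200 * n ^ 2) := by
  refine Runs.seq (N₂ := 10) (Runs.loop (n := n) (d := 1) (c := 50) (C := 170) (fun m τ =>
    τ.nat .n = n ∧ τ.nat .h = h ∧ IsWidth W (τ.rarr .width) ∧
    ∀ a b, a < m → b ≤ n + 1 → τ.rarr .dist a b = ⊥)
    0 (h + 1) rfl (by simp [NExp.eval, hσh]) (by omega) hn (by omega) ?_ ?_ (by decide)) ?_ ?_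
  · exact ⟨hσn, hσh, hσw, by omega⟩
  · rintro m τ - hm ⟨hn', hh', hw', hd'⟩
    refine (Runs.loop (n := n) (d := 0) (c := 12) (C := 50) (fun v τ =>
      τ.nat .n = n ∧ τ.nat .h = h ∧ τ.nat .m = m ∧ IsWidth W (τ.rarr .width) ∧
      ∀ a b, (a < m ∨ a = m ∧ b < v) → b ≤ n + 1 → τ.rarr .dist a b = ⊥)
      0 (n + 2) rfl (by simp [NExp.eval, target, Store.setNat, hn']) (by omega) hn (by omega)
      ?_ ?_ (by decide)).mono ?_ le_rfl
    · exact ⟨hn', hh', rfl, hw', fun a b h1 h2 => hd' a b (by omega) h2⟩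
    · clear! τ
      rintro v τ - hv ⟨hn', hh', hm', hw', hd'⟩
      refine Runs.seq (N₁ := 4) (N₂ := 8) (Runs.putR rfl (by decide)) ?_ (by simp)
      rintro _ rfl
      refine Runs.putN ⟨hn', hh', hm', ?_, ?_⟩ (by decide)
      · intro a b h1 h2 h3
        rw [← hw' a b h1 h2 h3]
        simp [Store.setRArr, Store.setNArr, Store.setNat]
      · intro a b h1 h2
        by_cases h3 : a = m ∧ b = v
        · simp [Store.setRArr, Store.setNArr, Store.setNat, NExp.eval, RExp.eval, hm', h3]
        · rw [← hd' a b (by omega) h2]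
          simp [Store.setRArr, Store.setNArr, Store.setNat, NExp.eval, RExp.eval, hm', h3]
    · rintro τ ⟨h1, h2, -, h3, h4⟩
      exact ⟨h1, h2, h3, fun a b h5 h6 => h4 a b (by omega) h6⟩
  · rintro τ ⟨hn', hh', hw', hd'⟩
    refine Runs.putR ⟨hn', hh', ?_, ?_⟩ (by decide)
    · intro a b h1 h2 h3
      rw [← hw' a b h1 h2 h3]
      simp [Store.setRArr]
    · intro a b h1 h2
      rw [← hd' a b (by omega) h2]
      simp [Store.setRArr, NExp.eval, RExp.eval]
  · have := Nat.one_le_pow 2 n hn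
    norm_num
    omega

variable (W) in
/-- The largest width of a path of `m` edges to `v` whose last but one node is below `u`. -/
noncomputable def widestBelow (m v u : ℕ) : EReal :=
  (Finset.Ico (firstPred n v) u).sup fun u => min (widest W (m - 1) u) (blockWidth W u v)

theorem widestBelow_succ {m v u : ℕ} (hu : firstPred n v ≤ u) :
    widestBelow W m v (u + 1) =
      max (min (widest W (m - 1) u) (blockWidth W u v)) (widestBelow W m v u) := by
  rw [widestBelow, ← Finset.insert_Ico_right_eq_Ico_add_one hu, Finset.sup_insert]
  rfl

variable (W) in
/-- The cell `(m, v)` of the tables `dist` and `pre` after the Bellman-Ford iteration has treated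
the cells before `(M, V)`. -/
def BellmanFordCell (dist : ℕ → ℕ → EReal) (pre : ℕ → ℕ → ℕ) (M V m v : ℕ) : Prop :=
  ((m < M ∨ m = M ∧ v < V) → dist m v = widest W m v ∧
    (1 ≤ m → widest W m v ≠ ⊥ → IsPred W m v (pre m v))) ∧
  (¬ (m < M ∨ m = M ∧ v < V) → dist m v = ⊥)

/-- The cell holds the running maximum `widestBelow`, and the stored predecessor attains it as soon
as it is not `⊥`. Row `M - 1` is already final, so the candidates are the true ones. -/
theorem runs_updateCell (hn : 1 ≤ n) {M V : ℕ} (hM1 : 1 ≤ M) (hMh : M ≤ h) (hV : V ≤ n + 1)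
    {σ : Store} (hσn : σ.nat .n = n) (hσh : σ.nat .h = h) (hσm : σ.nat .m = M)
    (hσv : σ.nat .v = V) (hσlo : σ.nat .lo = firstPred n V) (hσw : IsWidth W (σ.rarr .width))
    (hσd : ∀ m v, m ≤ h → v ≤ n + 1 →
      BellmanFordCell W (σ.rarr .dist) (σ.narr .pre) M V m v) :
    Runs κ (.loop .u (.var .lo) (.var .v)
        (.ite (.ltR (.get .dist (.var .m) (.var .v)) candidate)
          (.putR .dist (.var .m) (.var .v) candidate ;;
            .putN .pre (.var .m) (.var .v) (.var .u))
          .skip)) σ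
      (fun τ => τ.nat .n = n ∧ τ.nat .h = h ∧ τ.nat .m = M ∧ IsWidth W (τ.rarr .width) ∧
        ∀ m v, m ≤ h → v ≤ n + 1 →
          BellmanFordCell W (τ.rarr .dist) (τ.narr .pre) M (V + 1) m v)
      (130 * n ^ 1) := by
  have hlo : firstPred n V ≤ V := by
    rw [firstPred]
    split_ifs <;> omega
  refine (Runs.loop (n := n) (d := 0) (c := 40) (C := 130) (fun u τ =>
    τ.nat .n = n ∧ τ.nat .h = h ∧ τ.nat .m = M ∧ τ.nat .v = V ∧ IsWidth W (τ.rarr .width) ∧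
    (∀ m v, m ≤ h → v ≤ n + 1 → ¬ (m = M ∧ v = V) →
      BellmanFordCell W (τ.rarr .dist) (τ.narr .pre) M V m v) ∧
    τ.rarr .dist M V = widestBelow W M V u ∧
    (widestBelow W M V u ≠ ⊥ → τ.narr .pre M V < u ∧ widestBelow W M V u ≤
      min (widest W (M - 1) (τ.narr .pre M V)) (blockWidth W (τ.narr .pre M V) V)))
    (firstPred n V) V (by exact hσlo) (by exact hσv) hlo hn (by omega) ?_ ?_ (by decide)).mono ?_ le_rfl
  · have h0 : widestBelow W M V (firstPred n V) = ⊥ := by simp [widestBelow]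
    refine ⟨hσn, hσh, hσm, hσv, hσw, fun m v h1 h2 _ => hσd m v h1 h2, ?_, fun h => absurd h0 h⟩
    rw [h0]
    exact (hσd M V hMh hV).2 (by omega)
  · rintro u τ hu1 hu2 ⟨hn', hh', hm', hv', hw', hd', hc', hp'⟩
    have hcand : candidate.eval (τ.setNat .u u) =
        min (widest W (M - 1) u) (blockWidth W u V) := by
      have e1 : (τ.setNat .u u).rarr .dist (M - 1) u = widest W (M - 1) u :=
        ((hd' (M - 1) u (by omega) (by omega) (by omega)).1 (by omega)).1
      have e2 : (τ.setNat .u u).rarr .width u V = blockWidth W u V := by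
        refine hw' u V hu2 hV ?_
        -- For the target the loop starts at `1`, so the undefined weight of `(s, t)` is never read.
        rintro ⟨rfl, rfl⟩
        rw [firstPred, if_pos rfl] at hu1
        omega
      rw [← e1, ← e2]
      simp [candidate, RExp.eval, NExp.eval, Store.setNat, hm', hv']
    have hdist : (RExp.get .dist (.var .m) (.var .v)).eval (τ.setNat .u u) =
        widestBelow W M V u := by
      rw [← hc']
      simp [RExp.eval, NExp.eval, Store.setNat, hm', hv']
    refine Runs.ite (M := 25) (fun h => ?_) (fun h => ?_) (by rw [pow_zero]; decide)
    · rw [BExp.holds, hdist, hcand] at h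
      refine Runs.seq (N₁ := 15) (N₂ := 10) (Runs.putR rfl (by decide)) ?_ le_rfl
      rintro _ rfl
      refine Runs.putN ⟨hn', hh', hm', hv', ?_, ?_, ?_, ?_⟩ (by decide)
      · intro a b h1 h2 h3
        rw [← hw' a b h1 h2 h3]
        simp [Store.setRArr, Store.setNArr, Store.setNat]
      · intro a b h1 h2 h3
        have := hd' a b h1 h2 h3
        simpa [BellmanFordCell, Store.setRArr, Store.setNArr, Store.setNat, NExp.eval, hm', hv',
          h3] using this
      · rw [widestBelow_succ hu1, max_eq_left h.le, ← hcand]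
        simp [Store.setRArr, Store.setNArr, Store.setNat, NExp.eval, hm', hv']
      · intro _
        rw [widestBelow_succ hu1, max_eq_left h.le]
        simp [Store.setRArr, Store.setNArr, Store.setNat, NExp.eval, hm', hv']
    · rw [BExp.holds, hdist, hcand, not_lt] at h
      refine Runs.skip ⟨hn', hh', hm', hv', hw', hd', ?_, ?_⟩ (by decide)
      · rw [widestBelow_succ hu1, max_eq_right h]
        exact hc'
      · rw [widestBelow_succ hu1, max_eq_right h]
        exact fun h4 => ⟨(hp' h4).1.trans (Nat.lt_succ_self u), (hp' h4).2⟩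
  · rintro τ ⟨hn', hh', hm', hv', hw', hd', hc', hp'⟩
    refine ⟨hn', hh', hm', hw', fun m v h1 h2 => ?_⟩
    by_cases h3 : m = M ∧ v = V
    · obtain ⟨rfl, rfl⟩ := h3
      -- Once all `u < v` are treated, the running maximum is the recursion for `widest`.
      have e : widestBelow W m v v = widest W m v := by
        obtain ⟨p, rfl⟩ : ∃ p, m = p + 1 := ⟨m - 1, by omega⟩
        rfl
      rw [e] at hc' hp'
      exact ⟨fun _ => ⟨hc', fun _ => hp'⟩, by omega⟩
    · obtain ⟨h4, h5⟩ := hd' m v h1 h2 h3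
      exact ⟨fun h6 => h4 (by omega), fun h6 => h5 (by omega)⟩

theorem runs_mainBellmanFord (hn : 1 ≤ n) (hh : h ≤ n + 1) {σ : Store} (hσn : σ.nat .n = n)
    (hσh : σ.nat .h = h) (hσw : IsWidth W (σ.rarr .width))
    (hσd : ∀ m v, m ≤ h → v ≤ n + 1 → σ.rarr .dist m v = if m = 0 ∧ v = 0 then ⊤ else ⊥) :
    Runs κ mainBellmanFord σ
      (fun τ => τ.nat .n = n ∧ τ.nat .h = h ∧
        (∀ m v, m ≤ h → v ≤ n + 1 → τ.rarr .dist m v = widest W m v) ∧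
        ∀ m v, 1 ≤ m → m ≤ h → v ≤ n + 1 → widest W m v ≠ ⊥ → IsPred W m v (τ.narr .pre m v))
      (1400 * n ^ 3) := by
  refine (Runs.loop (n := n) (d := 2) (c := 440) (C := 1400) (fun M τ =>
    τ.nat .n = n ∧ τ.nat .h = h ∧ IsWidth W (τ.rarr .width) ∧
    ∀ m v, m ≤ h → v ≤ n + 1 → BellmanFordCell W (τ.rarr .dist) (τ.narr .pre) M 0 m v)
    1 (h + 1) rfl (by simp [NExp.eval, hσh]) (by omega) hn (by omega) ?_ ?_ (by decide)).mono
    ?_ le_rfl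
  · refine ⟨hσn, hσh, hσw, fun m v h1 h2 => ⟨fun h3 => ?_, fun h3 => ?_⟩⟩
    · obtain rfl : m = 0 := by omega
      refine ⟨?_, by omega⟩
      rw [hσd 0 v h1 h2, widest]
      simp
    · rw [hσd m v h1 h2, if_neg (by omega)]
  · rintro M τ hM1 hM2 ⟨hn', hh', hw', hd'⟩
    refine (Runs.loop (n := n) (d := 1) (c := 140) (C := 440) (fun V τ =>
      τ.nat .n = n ∧ τ.nat .h = h ∧ τ.nat .m = M ∧ IsWidth W (τ.rarr .width) ∧
      ∀ m v, m ≤ h → v ≤ n + 1 → BellmanFordCell W (τ.rarr .dist) (τ.narr .pre) M V m v)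
      0 (n + 2) rfl (by simp [NExp.eval, target, Store.setNat, hn']) (by omega) hn (by omega)
      ?_ ?_ (by decide)).mono ?_ le_rfl
    · exact ⟨hn', hh', rfl, hw', hd'⟩
    · clear! τ
      rintro V τ - hV ⟨hn', hh', hm', hw', hd'⟩
      refine Runs.seq (N₁ := 10) (N₂ := 130 * n ^ 1) (P := fun τ => τ.nat .n = n ∧ τ.nat .h = h ∧
        τ.nat .m = M ∧ τ.nat .v = V ∧ τ.nat .lo = firstPred n V ∧ IsWidth W (τ.rarr .width) ∧
        ∀ m v, m ≤ h → v ≤ n + 1 →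
          BellmanFordCell W (τ.rarr .dist) (τ.narr .pre) M V m v) ?_ ?_ ?_
      · have e : (BExp.eqN (.var .v) target).holds (τ.setNat .v V) ↔ V = n + 1 := by
          simp [BExp.holds, NExp.eval, target, Store.setNat, hn']
        refine Runs.ite (M := 2) (fun h => ?_) (fun h => ?_) (by decide)
        · exact Runs.setN ⟨hn', hh', hm', rfl, by rw [firstPred, if_pos (e.1 h)]; rfl, hw', hd'⟩
            (by decide)
        · exact Runs.setN ⟨hn', hh', hm', rfl, by rw [firstPred, if_neg (mt e.2 h)]; rfl, hw',
            hd'⟩ (by decide)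
      · rintro τ ⟨h1, h2, h3, h4, h5, h6, h7⟩
        exact runs_updateCell hn hM1 (by omega) (by omega) h1 h2 h3 h4 h5 h6 h7
      · rw [pow_one]
        omega
    · rintro τ ⟨h1, h2, -, h3, h4⟩
      refine ⟨h1, h2, h3, fun m v h5 h6 => ?_⟩
      obtain ⟨h7, h8⟩ := h4 m v h5 h6
      exact ⟨fun h6 => h7 (by omega), fun h6 => h8 (by omega)⟩
  · rintro τ ⟨h1, h2, -, h3⟩
    exact ⟨h1, h2, fun m v h4 h5 => ((h3 m v h4 h5).1 (by omega)).1,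
      fun m v h4 h5 h6 => ((h3 m v h5 h6).1 (by omega)).2 h4⟩

/-- Optimality needs only a length at most `h` with the same width at `t`, not a minimal one. Rounds
after the first failed test change nothing. -/
theorem runs_chooseLength (hn : 1 ≤ n) (hh : h ≤ n + 1) {σ : Store} (hσn : σ.nat .n = n)
    (hσh : σ.nat .h = h) :
    Runs κ chooseLength σ
      (fun τ => τ.nat .n = n ∧ τ.narr .pre = σ.narr .pre ∧ τ.nat .last ≤ h ∧
        σ.rarr .dist (τ.nat .last) (n + 1) = σ.rarr .dist h (n + 1))
      (80 * n ^ 1) := by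
  refine Runs.seq (N₁ := 2) (Runs.setN rfl (by decide)) ?_ ?_ (N₂ := 70 * n ^ 1)
  · rintro _ rfl
    refine (Runs.loop (n := n) (d := 0) (c := 20) (C := 70) (fun _ τ =>
      τ.nat .n = n ∧ τ.narr .pre = σ.narr .pre ∧ τ.rarr .dist = σ.rarr .dist ∧
      τ.nat .last ≤ h ∧ σ.rarr .dist (τ.nat .last) (n + 1) = σ.rarr .dist h (n + 1))
      0 h rfl (by exact hσh) (by omega) hn (by omega) ?_ ?_ (by decide)).mono ?_ le_rfl
    · exact ⟨hσn, rfl, rfl, hσh.le, congrArg (fun x => σ.rarr .dist x (n + 1)) hσh⟩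
    · rintro i τ - - ⟨hn', hp', hd', hl', he'⟩
      refine Runs.ite (M := 5) (fun h => ?_) (fun h => ?_) (by rw [pow_zero]; decide)
      · refine Runs.setN ⟨hn', hp', hd', ?_, ?_⟩ (by decide)
        · exact (Nat.sub_le _ _).trans hl'
        · have h1 : σ.rarr .dist (τ.nat .last) (n + 1) =
              σ.rarr .dist (τ.nat .last - 1) (n + 1) := by
            simpa [BExp.holds, RExp.eval, NExp.eval, target, Store.setNat, hn', hd'] using h
          exact h1.symm.trans he'
      · exact Runs.skip ⟨hn', hp', hd', hl', he'⟩ (by decide)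
    · rintro τ ⟨h1, h2, -, h3, h4⟩
      exact ⟨h1, h2, h3, h4⟩
  · rw [pow_one]
    omega

/-- A path of `l` edges has `l` nodes besides the source, which is not stored. Two of them are
written before the loop, hence `2 ≤ l`. -/
theorem runs_retrievePath (hn : 1 ≤ n) {l : ℕ} (hl : 2 ≤ l) (hln : l ≤ n + 1) {σ : Store}
    (hσn : σ.nat .n = n) (hσl : σ.nat .last = l) :
    Runs κ retrievePath σ
      (fun τ => τ.nat .n = n ∧ τ.nat .len = l ∧ τ.narr .path 0 0 = n + 1 ∧
        ∀ j, j + 1 < l → τ.narr .path (j + 1) 0 = σ.narr .pre (l - j) (τ.narr .path j 0))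
      (120 * n ^ 1) := by
  refine Runs.seq (N₁ := 10) (N₂ := 30 + 70 * n ^ 1) (Runs.putN rfl (by decide)) ?_ ?_
  · rintro _ rfl
    refine Runs.seq (N₁ := 10) (N₂ := 20 + 70 * n ^ 1) (Runs.setN rfl (by decide)) ?_ (by omega)
    rintro _ rfl
    refine Runs.seq (N₁ := 10) (N₂ := 10 + 70 * n ^ 1) (Runs.putN rfl (by decide)) ?_ (by omega)
    rintro _ rfl
    refine Runs.seq (N₁ := 10) (N₂ := 70 * n ^ 1) (Runs.setN rfl (by decide)) ?_ (by omega)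
    rintro _ rfl
    refine (Runs.loop (n := n) (d := 0) (c := 20) (C := 70) (fun i τ =>
      τ.nat .n = n ∧ τ.nat .last = l ∧ τ.nat .len = i ∧ τ.narr .pre = σ.narr .pre ∧
      τ.nat .u = τ.narr .path (i - 1) 0 ∧ τ.narr .path 0 0 = n + 1 ∧
      ∀ j, j + 1 < i → τ.narr .path (j + 1) 0 = σ.narr .pre (l - j) (τ.narr .path j 0))
      2 l rfl (by exact hσl) hl hn (by omega) ?_ ?_ (by decide)).mono ?_ le_rfl
    · refine ⟨hσn, hσl, rfl, ?_, ?_, ?_, ?_⟩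
      · funext p q
        simp [Store.setNat, Store.setNArr]
      · simp [Store.setNat, Store.setNArr, NExp.eval]
      · simp [Store.setNat, Store.setNArr, NExp.eval, target, hσn]
      · intro j hj
        obtain rfl : j = 0 := by omega
        simp [Store.setNat, Store.setNArr, NExp.eval, target, hσn, hσl]
    · rintro i τ hi1 hi2 ⟨hn', hl', hlen', hp', hu', h0', hs'⟩
      refine Runs.seq (N₁ := 6) (N₂ := 14) (Runs.setN rfl (by decide)) ?_ (by simp)
      rintro _ rfl
      refine Runs.seq (N₁ := 5) (N₂ := 9) (Runs.setN rfl (by decide)) ?_ (by simp)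
      rintro _ rfl
      refine Runs.seq (N₁ := 4) (N₂ := 5) (Runs.putN rfl (by decide)) ?_ (by simp)
      rintro _ rfl
      have hi0 : i ≠ 0 := by omega
      refine Runs.setN ⟨hn', hl', ?_, ?_, ?_, ?_, ?_⟩ (by decide)
      · simp [Store.setNat, Store.setNArr, NExp.eval, hlen']
      · rw [← hp']
        funext p q
        simp [Store.setNat, Store.setNArr]
      · simp [Store.setNat, Store.setNArr, NExp.eval, hlen']
      · rw [← h0']
        simp [Store.setNat, Store.setNArr, NExp.eval, hlen', Ne.symm hi0]
      · intro j hj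
        by_cases h : j + 1 = i
        · subst h
          have e : l + 1 - (j + 1) = l - j := by omega
          simp [Store.setNat, Store.setNArr, NExp.eval, hlen', hl', hu', hp', e]
        · have h1 : j ≠ i := by omega
          simp [Store.setNat, Store.setNArr, NExp.eval, hlen', h, h1, hs' j (by omega)]
    · rintro τ ⟨h1, -, h2, -, -, h3, h4⟩
      exact ⟨h1, h2, h3, h4⟩
  · rw [pow_one]
    omega

theorem runs_writeLeaders (hn : 1 ≤ n) {l : ℕ} (hln : l ≤ n + 1) {σ : Store}
    (hσn : σ.nat .n = n) (hσl : σ.nat .len = l) :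
    Runs κ writeLeaders σ
      (fun τ => ∀ v, 1 ≤ v → v ≤ n →
        (τ.narr .leader v 0 = 1 ↔ ∃ j < l, σ.narr .path j 0 = v))
      (150 * n ^ 1) := by
  refine Runs.seq (N₁ := 30 * n ^ 1) (N₂ := 100 * n ^ 1 + 20) (Runs.loop (n := n) (d := 0) (c := 4)
    (C := 30) (fun i τ => τ.nat .n = n ∧ τ.nat .len = l ∧ τ.narr .path = σ.narr .path ∧
      ∀ v, v < i → τ.narr .leader v 0 = 0)
    0 (n + 2) rfl (by simp [NExp.eval, target, hσn]) (by omega) hn (by omega) ?_ ?_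
      (by decide)) ?_ ?_
  · exact ⟨hσn, hσl, rfl, by omega⟩
  · rintro i τ - hi ⟨hn', hl', hp', h0'⟩
    refine Runs.putN ⟨hn', hl', ?_, ?_⟩ (by rw [pow_zero]; decide)
    · rw [← hp']
      funext p q
      simp [Store.setNat, Store.setNArr]
    · intro v hv
      by_cases h : v = i
      · simp [Store.setNat, Store.setNArr, NExp.eval, h]
      · simpa [Store.setNat, Store.setNArr, NExp.eval, h] using h0' v (by omega)
  · rintro τ ⟨hn', hl', hp', h0'⟩
    refine Runs.seq (N₁ := 100 * n ^ 1) (N₂ := 20) (Runs.loop (n := n) (d := 0) (c := 30) (C := 100)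
      (fun i τ => τ.nat .n = n ∧ τ.narr .path = σ.narr .path ∧
        ∀ v, 1 ≤ v → v ≤ n → (τ.narr .leader v 0 = 1 ↔ ∃ j < i, σ.narr .path j 0 = v))
      0 l rfl (by exact hl') (by omega) hn (by omega) ?_ ?_ (by decide)) ?_ (by omega)
    · refine ⟨hn', hp', fun v h1 h2 => ?_⟩
      rw [h0' v (by omega)]
      simp
    · clear! τ
      rintro i τ - hi ⟨hn', hp', hs'⟩
      refine Runs.seq (N₁ := 5) (N₂ := 25) (P := fun τ => τ.nat .n = n ∧
        τ.narr .path = σ.narr .path ∧ τ.nat .u = σ.narr .path i 0 ∧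
        ∀ v, 1 ≤ v → v ≤ n → (τ.narr .leader v 0 = 1 ↔ ∃ j < i, σ.narr .path j 0 = v))
        (Runs.setN ⟨hn', hp', ?_, hs'⟩ (by decide)) ?_ (by simp)
      · rw [← hp']
        rfl
      · clear! τ
        rintro τ ⟨hn', hp', hu', hs'⟩
        -- The test discards only `s` and `t`, so no node `v` with `1 ≤ v ≤ n` is lost.
        have e : (BExp.and (.not (.eqN (.var .u) (.lit 0)))
            (.not (.eqN (.var .u) target))).holds τ ↔
            ¬ σ.narr .path i 0 = 0 ∧ ¬ σ.narr .path i 0 = n + 1 := by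
          simp [BExp.holds, NExp.eval, target, hn', hu']
        refine Runs.ite (M := 5) (fun h => ?_) (fun h => ?_) (by decide)
        · refine Runs.putN ⟨hn', ?_, fun v h1 h2 => ?_⟩ (by decide)
          · rw [← hp']
            funext p q
            simp [Store.setNArr]
          · simp only [Nat.lt_succ_iff_lt_or_eq, or_and_right, exists_or, exists_eq_left,
              ← hs' v h1 h2]
            by_cases h3 : σ.narr .path i 0 = v
            · simp [Store.setNArr, NExp.eval, hu', h3]
            · simp [Store.setNArr, NExp.eval, hu', h3, Ne.symm h3]
        · refine Runs.skip ⟨hn', hp', fun v h1 h2 => ?_⟩ (by decide)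
          have h3 : σ.narr .path i 0 ≠ v := by
            rw [e] at h
            omega
          simp only [Nat.lt_succ_iff_lt_or_eq, or_and_right, exists_or, exists_eq_left,
            ← hs' v h1 h2, h3, or_false]
    · rintro τ ⟨-, -, h⟩
      exact Runs.putR h (by decide)
  · rw [pow_one]
    omega

end Phases

/-! ### Composition of the phases and the theorem. -/

theorem runs_leaderSelection {κ n k : ℕ} (hk : 1 ≤ k) (hkn : k ≤ n) {W : Fin n → Fin n → ℝ}
    (hW : ∀ i j, (SimpleGraph.pathGraph n).Adj i j → W i j = W j i) :
    Runs κ leaderSelection (input n k W)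
      (fun τ => (leaderSet n τ).card ≤ k ∧
        widest W (k + 1) (n + 1) ≤ convRate (SimpleGraph.pathGraph n) W (leaderSet n τ))
      ((3000 + 9 * κ) * n ^ 3) := by
  have hn : 1 ≤ n := hk.trans hkn
  have hh : k + 1 ≤ n + 1 := by omega
  have h13 : n ^ 1 ≤ n ^ 3 := Nat.pow_le_pow_right hn (by norm_num)
  have h23 : n ^ 2 ≤ n ^ 3 := Nat.pow_le_pow_right hn (by norm_num)
  have h03 : 1 ≤ n ^ 3 := Nat.one_le_pow 3 n hn
  refine Runs.seq (runs_buildLaplacian hn) ?_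
    (N₂ := (2500 + 9 * κ) * n ^ 3) (by rw [Nat.add_mul, Nat.add_mul]; omega)
  rintro τ ⟨hn', hk', hl'⟩
  refine Runs.seq (runs_buildDigraph hn hn' hk' hl') ?_
    (N₂ := 2100 * n ^ 3) (by rw [Nat.add_mul, Nat.add_mul]; omega)
  clear! τ
  rintro τ ⟨hn', hk', hw'⟩
  refine Runs.seq (N₁ := 4) (N₂ := 2000 * n ^ 3) (P := fun τ => τ.nat .n = n ∧
    τ.nat .h = k + 1 ∧ IsWidth W (τ.rarr .width)) (Runs.setN ⟨hn', ?_, hw'⟩ (by decide)) ?_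
    (by omega)
  · simp [Store.setNat, NExp.eval, hk']
  clear! τ
  rintro τ ⟨hn', hh', hw'⟩
  refine Runs.seq (runs_initBellmanFord hn hh hn' hh' hw') ?_ (N₂ := 1800 * n ^ 3) (by omega)
  clear! τ
  rintro τ ⟨hn', hh', hw', hd'⟩
  refine Runs.seq (runs_mainBellmanFord hn hh hn' hh' hw' hd') ?_ (N₂ := 400 * n ^ 3) (by omega)
  clear! τ
  rintro τ ⟨hn', hh', hd', hp'⟩
  refine Runs.seq (runs_chooseLength hn hh hn' hh') ?_ (N₂ := 300 * n ^ 3) (by omega)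
  rintro ρ ⟨hρn, hρp, hρl, hρe⟩
  obtain ⟨l, hl⟩ : ∃ l, ρ.nat .last = l := ⟨_, rfl⟩
  rw [hl] at hρl hρe
  rw [hd' l _ hρl le_rfl, hd' (k + 1) _ le_rfl le_rfl] at hρe
  have hbot := widest_ne_bot hW hk hkn
  -- From here the optimum is expressed with the chosen length `l`, to which the retrieved path
  -- belongs.
  rw [← hρe] at hbot ⊢
  have hl2 : 2 ≤ l := by
    by_contra hcon
    interval_cases l
    · exact hbot widest_zero_target
    · exact hbot widest_one_target
  refine Runs.seq (runs_retrievePath hn hl2 (by omega) hρn hl) ?_ (N₂ := 150 * n ^ 3) (by omega)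
  rintro π ⟨hπn, hπl, hπ0, hπs⟩
  refine (runs_writeLeaders hn (by omega) hπn hπl).mono ?_ (by omega)
  intro ω hω
  obtain ⟨h1, h2⟩ := le_convRate_of_isPred hW (l := l) (by omega) hbot
    (pre := τ.narr .pre) (fun m v h1 h2 => hp' m v h1 (by omega))
    (q := fun j => π.narr .path j 0) hπ0 (fun j hj => by simp only [hπs j hj, hρp])
    (S := leaderSet n ω) (fun i => by
      rw [leaderSet, Finset.mem_filter, hω _ (by omega) (by omega)]
      simp)
  exact ⟨by omega, h1⟩

end RealRAM

theorem theorem3 (κ : ℕ) :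
    ∃ C : ℕ, ∀ (n k : ℕ), 1 ≤ k → k ≤ n → ∀ W : Fin n → Fin n → ℝ,
      (∀ i j, (SimpleGraph.pathGraph n).Adj i j → 0 < W i j ∧ W i j = W j i) →
      (RealRAM.output κ n k W).card ≤ k ∧
        (∀ S : Finset (Fin n), S.card ≤ k →
          convRate (SimpleGraph.pathGraph n) W S ≤
            convRate (SimpleGraph.pathGraph n) W (RealRAM.output κ n k W)) ∧
        RealRAM.operations κ n k W ≤ C * n ^ 3 := by
  refine ⟨3000 + 9 * κ, fun n k hk hkn W hW => ?_⟩
  have hW' : ∀ i j, (SimpleGraph.pathGraph n).Adj i j → W i j = W j i :=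
    fun i j h => (hW i j h).2
  obtain ⟨⟨h1, h2⟩, h3⟩ := RealRAM.runs_leaderSelection (κ := κ) hk hkn hW'
  exact ⟨h1, fun S hS => (RealRAM.convRate_le_widest hW' hk hkn hS).trans h2, h3⟩
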